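/- **Setting.** For a finite set $P$ of propositions, a timed word over $P$ is a finite sequence $\rho=(\sigma_1,\tau_1)\dots(\sigma_m,\tau_m)$ with $\emptyset\neq\sigma_i\subseteq P$ and real time stamps $0=\tau_1\le\tau_2\le\dots\le\tau_m$. A *time interval* is a nonempty open, half-open or closed interval of reals with both end points in $\mathbb N\cup\{0,\infty\}$ or both in $\{0,-1,-2,\dots\}\cup\{-\infty\}$. A set of intervals is *non-adjacent* if $\inf I\neq\sup J$ for all $I,J$ in it ($I=J$ included). **1-ATA.** A one-clock (one-way) alternating timed automaton has finitely many locations, an initial location, a set of final locations, and for every location and letter a transition formula built from $\top$, $\bot$, locations $q$, clock constraints $x\bowtie k$ ($k\in\mathbb N$, ${\bowtie}\in\{<,\le,>,\ge\}$), $\wedge$, $\vee$ and the clock reset $x.\varphi$. It accepts a timed word if some run, starting with clock value $0$ in the initial location, ends with all its locations final. **2-way 1-ATA.** A two-way 1-ATA has finitely many locations, each either forward or backward moving, an initial location (possibly $\top$ or $\bot$), a finite set $\mathcal G$ of time intervals (guards), and a transition function $\delta$ that assigns to each location, symbol (a letter or an end marker $\vdash,\dashv$) and guard a finite disjunction (empty: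 $\bot$) of nonempty finite conjunctions of literals $q$ and $x.q$, with $q$ a location, $\top$ or $\bot$. On $\vdash$ (resp. $\dashv$), a backward (forward) moving location leads only to forward (backward) moving locations, $\top$ or $\bot$. On $\rho$, head positions are $0,\dots,m+1$, with $\vdash$ at position $0$, $\dashv$ at $m+1$, $\tau_0=0$ and $\tau_{m+1}=\tau_m$. From a state $(q,\mu,h)$ the head moves to $h'=h+1$ or $h'=h-1$ according to the direction of $q$, the clock becomes $\mu'=\mu+\tau_{h'}-\tau_h$ (possibly negative), the symbol at $h'$ is read, a guard $g\in\mathcal G$ with $\mu'\in g$ and a disjunct of the corresponding formula are chosen, and the state is replaced by the states $(q',\mu',h')$ for the literals $q'$ and $(q',0,h')$ for the literals $x.q'$ of that disjunct; the states $\top$ and $\bot$ stay. A configuration is a set of states, and all its states move simultaneously. The word is accepted if from the initial location with clock value $0$ at position $0$ the configuration $\{\top\}$ can be reached in finitely many steps. **NA-2-way 1-ATA-rfl.** This is a 2-way 1-ATA whose locations are partitioned into islands, each with a header location, such that: the initial location is a header (or $\top$ or $\bot$); literals $q$ in transitions leaving a location of an island lead to non-header locations of the same island; literals $x.q$ lead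 to headers; for some strict partial order on the islands, every literal $x.q$ leads to a strictly smaller island (reset-free loops); and for each island, the set of the guards of its outgoing transitions (those whose formula is not $\bot$) is non-adjacent. **NA-GQMSO.** GQMSO extends $\mathrm{MSO}[<]$ over the positions of timed words by time constraint formulas $\psi(t)=\mathcal Q_1t_1\in t+I_1\dots\mathcal Q_jt_j\in t+I_j.\ \varphi(t,t_1,\dots,t_j)$ with $j\ge1$, where each $\mathcal Q_k$ is $\overline\exists$ or $\overline\forall$ ranging over the positions whose time stamp differs from that of $t$ by an element of the time interval $I_k$, and where $\varphi$ is a formula with no free variables other than $t,t_1,\dots,t_j$ (in particular no second-order ones). A formula is in NA-GQMSO if all these quantifiers are existential and $\{I_1,\dots,I_j\}$ is non-adjacent for each block. **Theorem.** Let $\mathsf{L_{insterr}}$ be the set of timed words over $P=\{b\}$ such that (1) the first position exists and has time stamp $0$, (2) the points with time stamp in $(0,1)$ are exactly those at positions $2$ and $3$ (both of which exist), and (3) exactly one position has its time stamp in $[\tau_2+1,\tau_3+1]$. Then $\mathsf{L_{insterr}}$ is the language of some NA-2-way 1-ATA-rfl and of some NA-GQMSO sentence, but it is not the language of any 1-ATA.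 Hence NA-2-way 1-ATA-rfl can specify properties that are inexpressible in 1-ATA. -/

import Mathlib

namespace TimedLang

/-! ### Timed words -/

/-- The letters over a set `P` of propositions: the nonempty finite sets of propositions. -/
abbrev Letter (P : Type) : Type := {s : Finset P // s.Nonempty}

/-- A finite timed word over `A`: letters with weakly increasing time stamps, the first time
stamp (if there is one) being `0`. Positions are `Fin length`, so position `i` of the usual
`1`-based counting is the element with value `i - 1`. -/
structure TimedWord (A : Type) where
  length : ℕ
  letter : Fin length → A
  time : Fin length → ℝ
  mono : Monotone time
  first_zero : ∀ i : Fin length, (i : ℕ) = 0 → time i = 0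

/-- Letters extended with the left and the right end marker. -/
inductive Marked (A : Type) where
  | left : Marked A
  | right : Marked A
  | letter (a : A) : Marked A

namespace TimedWord

variable {A : Type}

/-- Time stamp at head position `h` in `{0, …, m + 1}`, where `m` is the length: `τ₀ = 0`,
`τ₁, …, τ_m` are the time stamps of the word and `τ_{m+1} = τ_m`. -/
noncomputable def timeAt (ρ : TimedWord A) : ℕ → ℝ
  | 0 => 0
  | h + 1 =>
    if hl : h < ρ.length then ρ.time ⟨h, hl⟩
    else if hp : 0 < ρ.length then ρ.time ⟨ρ.length - 1, Nat.sub_lt hp Nat.one_pos⟩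
    else 0

/-- Symbol at head position `h` in `{0, …, m + 1}`: the left end marker at `0`, the letters of the
word at `1, …, m`, and the right end marker at `m + 1`. -/
def symbolAt (ρ : TimedWord A) : ℕ → Marked A
  | 0 => Marked.left
  | h + 1 => if hl : h < ρ.length then Marked.letter (ρ.letter ⟨h, hl⟩) else Marked.right

end TimedWord

/-! ### Time intervals -/

/-- Nonempty open, half-open or closed intervals of reals whose end points are integers or
infinite and which lie on one side of `0`: either both end points are in `{0, 1, 2, …} ∪ {∞}`, or
both are in `{…, -2, -1, 0} ∪ {-∞}`. -/
structure TimeInterval where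
  lo : WithBot ℤ
  hi : WithTop ℤ
  loClosed : Bool
  hiClosed : Bool
  one_sided : 0 ≤ lo ∨ hi ≤ 0
  nonempty : ∃ x : ℝ,
    (∀ a : ℤ, lo = a → if loClosed then (a : ℝ) ≤ x else (a : ℝ) < x) ∧
    (∀ b : ℤ, hi = b → if hiClosed then x ≤ (b : ℝ) else x < (b : ℝ))

namespace TimeInterval

/-- The set of reals of the interval. -/
def toSet (I : TimeInterval) : Set ℝ :=
  {x | (∀ a : ℤ, I.lo = a → if I.loClosed then (a : ℝ) ≤ x else (a : ℝ) < x) ∧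
       (∀ b : ℤ, I.hi = b → if I.hiClosed then x ≤ (b : ℝ) else x < (b : ℝ))}

/-- Infimum, an extended real. -/
noncomputable def inf (I : TimeInterval) : EReal := sInf ((fun x : ℝ => (x : EReal)) '' I.toSet)

/-- Supremum, an extended real. -/
noncomputable def sup (I : TimeInterval) : EReal := sSup ((fun x : ℝ => (x : EReal)) '' I.toSet)

end TimeInterval

/-- A set of intervals is non-adjacent if `inf I ≠ sup J` for all `I`, `J` in it (`I = J`
included, so that punctual intervals are excluded). -/
def NonAdjacent (S : Set TimeInterval) : Prop :=
  ∀ I ∈ S, ∀ J ∈ S, I.inf ≠ J.sup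

/-! ### One-clock alternating timed automata (one-way) -/

/-- Comparison symbols in clock constraints. -/
inductive Cmp where
  | lt | le | gt | ge

/-- `c.Holds v k` is the constraint `v ⋈ k`. -/
def Cmp.Holds : Cmp → ℝ → ℕ → Prop
  | .lt, v, k => v < k
  | .le, v, k => v ≤ k
  | .gt, v, k => (k : ℝ) < v
  | .ge, v, k => (k : ℝ) ≤ v

/-- Transition formulas `φ ::= ⊤ | ⊥ | q | x ⋈ k | φ ∧ φ | φ ∨ φ | x.φ`, where `x.φ` resets the
clock. -/
inductive TransFormula (Q : Type) where
  | top : TransFormula Q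
  | bot : TransFormula Q
  | loc (q : Q) : TransFormula Q
  | clock (c : Cmp) (k : ℕ) : TransFormula Q
  | and (φ ψ : TransFormula Q) : TransFormula Q
  | or (φ ψ : TransFormula Q) : TransFormula Q
  | reset (φ : TransFormula Q) : TransFormula Q

/-- `φ.Models M v`: the set `M` of states (locations with clock values) is a model of `φ` when the
clock has value `v`. -/
def TransFormula.Models {Q : Type} : TransFormula Q → Set (Q × ℝ) → ℝ → Prop
  | .top, _, _ => True
  | .bot, _, _ => False
  | .loc q, M, v => (q, v) ∈ M
  | .clock c k, _, v => c.Holds v k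
  | .and φ ψ, M, v => φ.Models M v ∧ ψ.Models M v
  | .or φ ψ, M, v => φ.Models M v ∨ ψ.Models M v
  | .reset φ, M, _ => φ.Models M 0

/-- A one-clock alternating timed automaton (1-ATA) over the alphabet `A`. -/
structure OneATA (A : Type) where
  Loc : Type
  finite_loc : Finite Loc
  init : Loc
  final : Set Loc
  δ : Loc → A → TransFormula Loc

namespace OneATA

variable {A : Type}

/-- `C'` is a successor of the configuration `C` (a set of states) after a delay `d` and the
letter `a`: a model of the transition formula is chosen for every state of `C`, and `C'` is the
union of the chosen models. -/
def Step (B : OneATA A) (d : ℝ) (a : A) (C C' : Set (B.Loc × ℝ)) : Prop :=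
  ∃ M : B.Loc × ℝ → Set (B.Loc × ℝ),
    (∀ s ∈ C, (B.δ s.1 a).Models (M s) (s.2 + d)) ∧ C' = ⋃ s ∈ C, M s

/-- There is a run over the whole word from the initial configuration (initial location, clock
value `0`) to a configuration all of whose locations are final. -/
def Accepts (B : OneATA A) (ρ : TimedWord A) : Prop :=
  ∃ C : ℕ → Set (B.Loc × ℝ),
    C 0 = {(B.init, 0)} ∧
    (∀ i : Fin ρ.length,
      B.Step (ρ.timeAt ((i : ℕ) + 1) - ρ.timeAt i) (ρ.letter i) (C i) (C ((i : ℕ) + 1))) ∧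
    ∀ s ∈ C ρ.length, s.1 ∈ B.final

def language (B : OneATA A) : Set (TimedWord A) := {ρ | B.Accepts ρ}

end OneATA

/-! ### Two-way one-clock alternating timed automata -/

/-- Locations extended with the accepting location `⊤` and the rejecting location `⊥`. -/
inductive ExtLoc (Q : Type) where
  | top : ExtLoc Q
  | bot : ExtLoc Q
  | loc (q : Q) : ExtLoc Q

/-- Literals `q` and `x.q`, where `q` is a location, `⊤` or `⊥`. -/
inductive Literal (Q : Type) where
  | free (q : ExtLoc Q) : Literal Q
  | reset (q : ExtLoc Q) : Literal Q

/-- The location in a literal. -/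
def Literal.target {Q : Type} : Literal Q → ExtLoc Q
  | .free q => q
  | .reset q => q

/-- Positive Boolean formulas in disjunctive normal form: a finite set (disjunction) of finite sets
(conjunctions) of literals. The empty disjunction is `⊥`. -/
abbrev DNF (Q : Type) : Type := Finset (Finset (Literal Q))

/-- A two-way one-clock alternating timed automaton (2-way 1-ATA) over the alphabet `A`. The
locations with `forward q` are the forward moving ones, all others are backward moving. The last
two fields say that the head cannot leave the word: at the left (right) end marker a backward
(forward) moving location can only be followed by forward (backward) moving ones. -/
structure TwoWayATA (A : Type) where
  Loc : Type
  finite_loc : Finite Loc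
  forward : Loc → Prop
  init : ExtLoc Loc
  guards : Finset TimeInterval
  δ : Loc → Marked A → guards → DNF Loc
  conj_nonempty : ∀ q a g, ∀ c ∈ δ q a g, c.Nonempty
  left_turn : ∀ q g, ¬ forward q → ∀ c ∈ δ q Marked.left g, ∀ l ∈ c, ∀ q',
    l.target = ExtLoc.loc q' → forward q'
  right_turn : ∀ q g, forward q → ∀ c ∈ δ q Marked.right g, ∀ l ∈ c, ∀ q',
    l.target = ExtLoc.loc q' → ¬ forward q'

/-- States: `⊤`, `⊥`, or a location with a clock value and a head position. -/
inductive State (Q : Type) where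
  | top : State Q
  | bot : State Q
  | at (q : Q) (μ : ℝ) (h : ℕ) : State Q

/-- The state for an extended location, given clock value and head position. -/
def ExtLoc.toState {Q : Type} (μ : ℝ) (h : ℕ) : ExtLoc Q → State Q
  | .top => .top
  | .bot => .bot
  | .loc q => .at q μ h

/-- The state for a literal: the clock value is kept at a free location and is `0` at a location
under a reset. -/
def Literal.toState {Q : Type} (μ : ℝ) (h : ℕ) : Literal Q → State Q
  | .free q => q.toState μ h
  | .reset q => q.toState 0 h

namespace TwoWayATA

variable {A : Type}

/-- `𝒜.Succ ρ s C`: the configuration `C` (a set of states) is a successor of the state `s`. In a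
state `(q, μ, h)` the head moves to the neighbouring position `h'` in the direction of `q`, the
clock is updated to `μ' = μ + τ_{h'} - τ_h`, the symbol at `h'` is read, and a disjunct of a
transition whose guard is satisfied by `μ'` is chosen. -/
def Succ (𝒜 : TwoWayATA A) (ρ : TimedWord A) : State 𝒜.Loc → Set (State 𝒜.Loc) → Prop
  | .top, C => C = {State.top}
  | .bot, C => C = {State.bot}
  | .at q μ h, C =>
    ∃ h' : ℕ, h' ≤ ρ.length + 1 ∧
      (𝒜.forward q ∧ h' = h + 1 ∨ ¬ 𝒜.forward q ∧ h' + 1 = h) ∧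
      ∃ g : 𝒜.guards, μ + ρ.timeAt h' - ρ.timeAt h ∈ (g : TimeInterval).toSet ∧
        ∃ c ∈ 𝒜.δ q (ρ.symbolAt h') g,
          C = {s | ∃ l ∈ c, s = l.toState (μ + ρ.timeAt h' - ρ.timeAt h) h'}

/-- Successors of a configuration: unions of successors, one chosen for every state. -/
def Successor (𝒜 : TwoWayATA A) (ρ : TimedWord A) (C C' : Set (State 𝒜.Loc)) : Prop :=
  ∃ D : State 𝒜.Loc → Set (State 𝒜.Loc), (∀ s ∈ C, 𝒜.Succ ρ s (D s)) ∧ C' = ⋃ s ∈ C, D s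

/-- Successors after `n` steps. -/
def SuccessorIter (𝒜 : TwoWayATA A) (ρ : TimedWord A) :
    ℕ → Set (State 𝒜.Loc) → Set (State 𝒜.Loc) → Prop
  | 0, C, C' => C = C'
  | n + 1, C, C' => ∃ C'', 𝒜.SuccessorIter ρ n C C'' ∧ 𝒜.Successor ρ C'' C'

/-- The word is accepted if the configuration `{⊤}` can be reached, in finitely many steps, from
the initial location with clock value `0` at head position `0`. -/
def Accepts (𝒜 : TwoWayATA A) (ρ : TimedWord A) : Prop :=
  ∃ n : ℕ, 𝒜.SuccessorIter ρ n {𝒜.init.toState 0 0} {State.top}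

def language (𝒜 : TwoWayATA A) : Set (TimedWord A) := {ρ | 𝒜.Accepts ρ}

/-- `q'` occurs free, that is outside resets, in an outgoing transition of `q`. -/
def FreeEdge (𝒜 : TwoWayATA A) (q q' : 𝒜.Loc) : Prop :=
  ∃ a g, ∃ c ∈ 𝒜.δ q a g, Literal.free (ExtLoc.loc q') ∈ c

/-- `x.q'` occurs in an outgoing transition of `q`. -/
def ResetEdge (𝒜 : TwoWayATA A) (q q' : 𝒜.Loc) : Prop :=
  ∃ a g, ∃ c ∈ 𝒜.δ q a g, Literal.reset (ExtLoc.loc q') ∈ c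

/-- Island normal form: the locations are partitioned into the islands `0, …, n - 1` with header
locations `header j`; transitions without reset stay in the island and do not lead to its header;
transitions with reset lead to headers. The initial location is a header (or `⊤` or `⊥`). -/
structure IslandNormalForm (𝒜 : TwoWayATA A) {n : ℕ} (island : 𝒜.Loc → Fin n)
    (header : Fin n → 𝒜.Loc) : Prop where
  header_mem : ∀ j, island (header j) = j
  init_header : ∀ q, 𝒜.init = ExtLoc.loc q → ∃ j, header j = q
  free_edge : ∀ q q', 𝒜.FreeEdge q q' → island q' = island q ∧ q' ≠ header (island q)
  reset_edge : ∀ q q', 𝒜.ResetEdge q q' → ∃ j, header j = q'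

/-- Reset-free loops, for an automaton with the given islands: there is a strict partial order on
the islands such that every reset transition leads to a strictly smaller island. -/
def ResetFreeLoops (𝒜 : TwoWayATA A) {n : ℕ} (island : 𝒜.Loc → Fin n) : Prop :=
  ∃ prec : Fin n → Fin n → Prop, IsStrictOrder (Fin n) prec ∧
    ∀ p q, 𝒜.ResetEdge p q → prec (island q) (island p)

/-- The intervals that guard an outgoing transition of some location of island `j` (a transition
is absent if its formula is the empty disjunction). -/
def islandIntervals (𝒜 : TwoWayATA A) {n : ℕ} (island : 𝒜.Loc → Fin n) (j : Fin n) :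
    Set TimeInterval :=
  {I | ∃ q a, ∃ g : 𝒜.guards, island q = j ∧ (𝒜.δ q a g).Nonempty ∧ (g : TimeInterval) = I}

/-- Non-adjacent 2-way 1-ATA with reset-free loops (NA-2-way 1-ATA-rfl). -/
def IsNonAdjacentRfl (𝒜 : TwoWayATA A) : Prop :=
  ∃ (n : ℕ) (island : 𝒜.Loc → Fin n) (header : Fin n → 𝒜.Loc),
    𝒜.IslandNormalForm island header ∧ 𝒜.ResetFreeLoops island ∧
    ∀ j, NonAdjacent (𝒜.islandIntervals island j)

end TwoWayATA

/-! ### Monadic second-order logic with guarded metric quantifiers (GQMSO) -/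

/-- Metric quantifiers. -/
inductive MetricQuantifier where
  | ex | all

/-- `GQMSO P n m`: formulas over the propositions `P` with free first-order variables among `n`
variables and free second-order variables among `m` variables. A quantifier binds the variable `0`
of its body. `timed t b φ` is the time constraint formula
`𝒬₁ t₁ ∈ t + I₁ … 𝒬_j t_j ∈ t + I_j. φ(t, t₁, …, t_j)` with `j ≥ 1` and `b = [(𝒬₁, I₁), …]`; in `φ`
the anchor `t` is variable `0` and `t_k` is variable `k`, and there are no other free variables, in
particular no second-order ones. -/
inductive GQMSO (P : Type) : ℕ → ℕ → Type where
  | eq {n m : ℕ} (t t' : Fin n) : GQMSO P n m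
  | lt {n m : ℕ} (t t' : Fin n) : GQMSO P n m
  | prop {n m : ℕ} (a : P) (t : Fin n) : GQMSO P n m
  | mem {n m : ℕ} (T : Fin m) (t : Fin n) : GQMSO P n m
  | and {n m : ℕ} (φ ψ : GQMSO P n m) : GQMSO P n m
  | not {n m : ℕ} (φ : GQMSO P n m) : GQMSO P n m
  | ex {n m : ℕ} (φ : GQMSO P (n + 1) m) : GQMSO P n m
  | exSet {n m : ℕ} (φ : GQMSO P n (m + 1)) : GQMSO P n m
  | timed {n m : ℕ} (t : Fin n) (b : List (MetricQuantifier × TimeInterval)) (hb : b ≠ [])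
      (φ : GQMSO P (b.length + 1) 0) : GQMSO P n m

/-- Semantics of a block of metric quantifiers anchored at position `i`. -/
def metricBlock {A : Type} (ρ : TimedWord A) (i : Fin ρ.length) :
    (b : List (MetricQuantifier × TimeInterval)) → ((Fin b.length → Fin ρ.length) → Prop) → Prop
  | [], R => R Fin.elim0
  | (MetricQuantifier.ex, I) :: b, R =>
    ∃ j : Fin ρ.length, ρ.time j - ρ.time i ∈ I.toSet ∧
      metricBlock ρ i b (fun v => R (Fin.cons j v))
  | (MetricQuantifier.all, I) :: b, R =>
    ∀ j : Fin ρ.length, ρ.time j - ρ.time i ∈ I.toSet →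
      metricBlock ρ i b (fun v => R (Fin.cons j v))

namespace GQMSO

variable {P : Type}

/-- Satisfaction in a timed word, under an assignment of positions and of sets of positions. -/
def Sat (ρ : TimedWord (Letter P)) : {n m : ℕ} → GQMSO P n m →
    (Fin n → Fin ρ.length) → (Fin m → Set (Fin ρ.length)) → Prop
  | _, _, .eq t t', v, _ => v t = v t'
  | _, _, .lt t t', v, _ => v t < v t'
  | _, _, .prop a t, v, _ => a ∈ (ρ.letter (v t)).1
  | _, _, .mem T t, v, V => v t ∈ V T
  | _, _, .and φ ψ, v, V => φ.Sat ρ v V ∧ ψ.Sat ρ v V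
  | _, _, .not φ, v, V => ¬ φ.Sat ρ v V
  | _, _, .ex φ, v, V => ∃ i : Fin ρ.length, φ.Sat ρ (Fin.cons i v) V
  | _, _, .exSet φ, v, V => ∃ X : Set (Fin ρ.length), φ.Sat ρ v (Fin.cons X V)
  | _, _, .timed t b _ φ, v, _ =>
    metricBlock ρ (v t) b (fun w => φ.Sat ρ (Fin.cons (v t) w) Fin.elim0)

/-- Non-adjacent (NA-)GQMSO formulas: all metric quantifiers are existential (alternation-free
fragment), and the intervals within each block form a non-adjacent set. -/
def IsNonAdjacent : {n m : ℕ} → GQMSO P n m → Prop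
  | _, _, .eq _ _ => True
  | _, _, .lt _ _ => True
  | _, _, .prop _ _ => True
  | _, _, .mem _ _ => True
  | _, _, .and φ ψ => φ.IsNonAdjacent ∧ ψ.IsNonAdjacent
  | _, _, .not φ => φ.IsNonAdjacent
  | _, _, .ex φ => φ.IsNonAdjacent
  | _, _, .exSet φ => φ.IsNonAdjacent
  | _, _, .timed _ b _ φ =>
    (∀ x ∈ b, x.1 = MetricQuantifier.ex) ∧ NonAdjacent {I | ∃ x ∈ b, x.2 = I} ∧ φ.IsNonAdjacent

/-- The language of a sentence. -/
def language (φ : GQMSO P 0 0) : Set (TimedWord (Letter P)) :=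
  {ρ | φ.Sat ρ Fin.elim0 Fin.elim0}

end GQMSO

/-! ### The language of an inserted error -/

/-- The language over the one-proposition set `{b}` (here `Unit`; its only letter is `{b}`) of the
timed words such that position `1` has time stamp `0`, the points in `(0, 1)` are exactly those at
positions `2` and `3`, and exactly one point lies in `[τ₂ + 1, τ₃ + 1]`. -/
def insertErr : Set (TimedWord (Letter Unit)) :=
  {ρ | ∃ h : 3 ≤ ρ.length,
    ρ.time ⟨0, by omega⟩ = 0 ∧
    (∀ i : Fin ρ.length,
      ρ.time i ∈ Set.Ioo (0 : ℝ) 1 ↔ i = ⟨1, by omega⟩ ∨ i = ⟨2, by omega⟩) ∧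
    ∃! p : Fin ρ.length,
      ρ.time p ∈ Set.Icc (ρ.time ⟨1, by omega⟩ + 1) (ρ.time ⟨2, by omega⟩ + 1)}

end TimedLang

/-!
Three independent facts are proved about the language of an inserted error: the points in `(0, 1)`
are the second and the third one, and exactly one point is in the window `[τ₂ + 1, τ₃ + 1]`.

*Two-way automaton.* The points of the window are consecutive, so a point is the only one in it iff
it is in the window, its predecessor is before `τ₂ + 1`, and its successor is after `τ₃ + 1`
(`mem_insertErr_iff`). The automaton guesses the predecessor. Each of the four comparisons is left
to an island of its own, which resets the clock at the point in question, goes back to the left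
end marker, and counts to the second or third point. Such an island uses the guard `(-∞, 0]` and one
comparison with `-1`; guards with two points in common are never adjacent
(`nonAdjacent_of_common_points`). Calls lead from the first island to the others only, so loops are
free of resets. Acceptance is analysed state by state: a configuration reaches `{⊤}` iff each of
its states does (`TwoWayATA.successorIter_top_iff`).

*Sentence.* The window is defined by two separate metric blocks, each with a single interval: the
second point is in `t + (-∞, -1]`, and the third point is in `t + [-1, 0]`.

*No one-way automaton.* A state of a one-way alternating automaton is a location with one reset
time, so after the third letter a state knows at most one of `τ₂` and `τ₃`. Fix the later
points, `n` of them in `(1, 2)`, and `n + 1` cuts in `(0, 1)` whose translates by `1` separate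
them. If `n` exceeds the number of sets of locations, then for two cuts `a < a'` the same locations,
reset at the cut, accept the later points. Taking `τ₂` to be the cut `a` or `a'`, and `τ₃` the cut
following `a'`, gives two words that are accepted or rejected together
(`OneATA.accepts_gridWord_congr`). But the first has at least two points in the window, and the
second has one (`gridWord_mem_insertErr_iff`).
-/

/-! ### Time intervals and head positions -/

namespace TimedLang

namespace TimeInterval

/-- The interval `[a, ∞)`. -/
def ray (a : ℤ) (ha : 0 ≤ a) : TimeInterval where
  lo := a
  hi := ⊤
  loClosed := true
  hiClosed := false
  one_sided := Or.inl (by exact_mod_cast ha)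
  nonempty := ⟨a, by simp⟩

/-- The interval `(-∞, b]` or `(-∞, b)`, closed iff `c` is true. -/
def coray (b : ℤ) (c : Bool) (hb : b ≤ 0) : TimeInterval where
  lo := ⊥
  hi := b
  loClosed := false
  hiClosed := c
  one_sided := Or.inr (by exact_mod_cast hb)
  nonempty := ⟨b - 1, by simp⟩

/-- The interval with end points `a < b`, which belong to it iff `c`, respectively `d`, is true. -/
def bounded (a b : ℤ) (c d : Bool) (hab : a < b) (h : 0 ≤ a ∨ b ≤ 0) : TimeInterval where
  lo := a
  hi := b
  loClosed := c
  hiClosed := d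
  one_sided := h.imp (fun h => by exact_mod_cast h) (fun h => by exact_mod_cast h)
  nonempty := ⟨(a + b) / 2, by
    have : (a : ℝ) < b := by exact_mod_cast hab
    constructor
    · rintro _ h
      obtain rfl := WithBot.coe_injective h
      split_ifs <;> linarith
    · rintro _ h
      obtain rfl := WithTop.coe_injective h
      split_ifs <;> linarith⟩

@[simp] theorem mem_ray {a : ℤ} {ha : 0 ≤ a} {x : ℝ} : x ∈ (ray a ha).toSet ↔ (a : ℝ) ≤ x := by
  simp [ray, toSet]

@[simp] theorem mem_coray {b : ℤ} {c : Bool} {hb : b ≤ 0} {x : ℝ} :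
    x ∈ (coray b c hb).toSet ↔ if c then x ≤ (b : ℝ) else x < (b : ℝ) := by
  cases c <;> simp [coray, toSet]

@[simp] theorem mem_bounded {a b : ℤ} {c d : Bool} {hab : a < b} {h : 0 ≤ a ∨ b ≤ 0} {x : ℝ} :
    x ∈ (bounded a b c d hab h).toSet ↔
      (if c then (a : ℝ) ≤ x else (a : ℝ) < x) ∧ (if d then x ≤ (b : ℝ) else x < (b : ℝ)) := by
  cases c <;> cases d <;> simp [bounded, toSet]

end TimeInterval

/-- Intervals with two common points `x < y` are non-adjacent: all their infima are at most `x`,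
and all their suprema are at least `y`. -/
theorem nonAdjacent_of_common_points {S : Set TimeInterval} {x y : ℝ} (hxy : x < y)
    (h : ∀ I ∈ S, x ∈ I.toSet ∧ y ∈ I.toSet) : NonAdjacent S := by
  intro I hI J hJ
  have hinf : I.inf ≤ x := sInf_le ⟨x, (h I hI).1, rfl⟩
  have hsup : (y : EReal) ≤ J.sup := le_sSup ⟨y, (h J hJ).2, rfl⟩
  exact (hinf.trans_lt ((EReal.coe_lt_coe_iff.2 hxy).trans_le hsup)).ne

namespace TimedWord

variable {A : Type} (ρ : TimedWord A)

theorem timeAt_succ {h : ℕ} (hh : h < ρ.length) : ρ.timeAt (h + 1) = ρ.time ⟨h, hh⟩ :=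
  dif_pos hh

theorem timeAt_monotone : Monotone ρ.timeAt := by
  refine monotone_nat_of_le_succ fun h => ?_
  cases h with
  | zero =>
    by_cases hl : 0 < ρ.length
    · rw [ρ.timeAt_succ hl, ρ.first_zero _ rfl]
      rfl
    · simp [timeAt, hl]
  | succ h =>
    by_cases hl : h + 1 < ρ.length
    · rw [ρ.timeAt_succ hl, ρ.timeAt_succ (by omega)]
      exact ρ.mono (by simp)
    · by_cases hl' : h < ρ.length
      · obtain rfl : h = ρ.length - 1 := by omega
        simp [timeAt, hl, hl', show 0 < ρ.length by omega]
      · simp [timeAt, hl, hl']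

theorem timeAt_one : ρ.timeAt 1 = 0 := by
  by_cases hl : 0 < ρ.length
  · rw [ρ.timeAt_succ hl, ρ.first_zero _ rfl]
  · simp [timeAt, hl]

theorem timeAt_nonneg (h : ℕ) : 0 ≤ ρ.timeAt h := ρ.timeAt_monotone (Nat.zero_le h)

end TimedWord

/-! ### Two-way automata: acceptance state by state -/

namespace TwoWayATA

variable {A : Type} (𝒜 : TwoWayATA A) (ρ : TimedWord A)

/-- The state `s` has a run of `n` simultaneous steps to the configuration `{⊤}`. -/
def AcceptsIn : ℕ → State 𝒜.Loc → Prop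
  | 0, s => s = State.top
  | n + 1, s => ∃ C, 𝒜.Succ ρ s C ∧ ∀ t ∈ C, AcceptsIn n t

/-- `𝒜` accepts `ρ` from the state `s`. -/
def AcceptsFrom (s : State 𝒜.Loc) : Prop := ∃ n, 𝒜.AcceptsIn ρ n s

variable {𝒜 ρ}

theorem acceptsIn_top (n : ℕ) : 𝒜.AcceptsIn ρ n State.top := by
  induction n with
  | zero => rfl
  | succ n ih => exact ⟨{State.top}, rfl, by rintro _ rfl; exact ih⟩

theorem AcceptsIn.succ {n : ℕ} {s : State 𝒜.Loc} (h : 𝒜.AcceptsIn ρ n s) :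
    𝒜.AcceptsIn ρ (n + 1) s := by
  induction n generalizing s with
  | zero =>
    obtain rfl : s = State.top := h
    exact acceptsIn_top 1
  | succ n ih =>
    obtain ⟨C, hC, h⟩ := h
    exact ⟨C, hC, fun t ht => ih (h t ht)⟩

theorem AcceptsIn.mono {n m : ℕ} (hnm : n ≤ m) {s : State 𝒜.Loc} (h : 𝒜.AcceptsIn ρ n s) :
    𝒜.AcceptsIn ρ m s := by
  induction hnm with
  | refl => exact h
  | step _ ih => exact ih.succ

theorem Succ.nonempty {s : State 𝒜.Loc} {C : Set (State 𝒜.Loc)} (h : 𝒜.Succ ρ s C) :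
    C.Nonempty := by
  match s, h with
  | .top, h => exact (show C = {State.top} from h) ▸ Set.singleton_nonempty _
  | .bot, h => exact (show C = {State.bot} from h) ▸ Set.singleton_nonempty _
  | .at q μ i, h =>
    obtain ⟨h', -, -, g, -, c, hc, rfl⟩ := h
    obtain ⟨l, hl⟩ := 𝒜.conj_nonempty _ _ _ c hc
    exact ⟨_, l, hl, rfl⟩

theorem successorIter_succ_iff {n : ℕ} {C C' : Set (State 𝒜.Loc)} :
    𝒜.SuccessorIter ρ (n + 1) C C' ↔ ∃ D, 𝒜.Successor ρ C D ∧ 𝒜.SuccessorIter ρ n D C' := by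
  induction n generalizing C' with
  | zero => simp [SuccessorIter]
  | succ n ih =>
    rw [SuccessorIter]
    simp only [ih]
    constructor
    · rintro ⟨E, ⟨D, hD, hE⟩, hC'⟩
      exact ⟨D, hD, E, hE, hC'⟩
    · rintro ⟨D, hD, E, hE, hC'⟩
      exact ⟨E, ⟨D, hD, hE⟩, hC'⟩

/-- A nonempty configuration reaches `{⊤}` in `n` steps iff each of its states does. -/
theorem successorIter_top_iff {n : ℕ} {C : Set (State 𝒜.Loc)} (hC : C.Nonempty) :
    𝒜.SuccessorIter ρ n C {State.top} ↔ ∀ s ∈ C, 𝒜.AcceptsIn ρ n s := by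
  induction n generalizing C with
  | zero => exact Set.eq_singleton_iff_nonempty_unique_mem.trans (and_iff_right hC)
  | succ n ih =>
    rw [successorIter_succ_iff]
    constructor
    · rintro ⟨_, ⟨D, hD, rfl⟩, h⟩ s hs
      have hne : (⋃ s ∈ C, D s).Nonempty :=
        (hD s hs).nonempty.mono (Set.subset_biUnion_of_mem (u := D) hs)
      exact ⟨D s, hD s hs, fun t ht => (ih hne).1 h t (Set.mem_biUnion hs ht)⟩
    · intro h
      choose! D hD h using h
      obtain ⟨s, hs⟩ := hC
      have hne : (⋃ s ∈ C, D s).Nonempty :=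
        (hD s hs).nonempty.mono (Set.subset_biUnion_of_mem (u := D) hs)
      refine ⟨_, ⟨D, hD, rfl⟩, (ih hne).2 fun t ht => ?_⟩
      obtain ⟨s, hs, ht⟩ := Set.mem_iUnion₂.1 ht
      exact h s hs t ht

theorem accepts_iff_acceptsFrom : 𝒜.Accepts ρ ↔ 𝒜.AcceptsFrom ρ (𝒜.init.toState 0 0) := by
  simp [Accepts, AcceptsFrom, successorIter_top_iff (Set.singleton_nonempty _)]

theorem acceptsFrom_top : 𝒜.AcceptsFrom ρ State.top := ⟨0, rfl⟩

variable (𝒜 ρ) in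
/-- `𝒜` accepts from the location `q` at head position `h`, when the clock was reset at time `r`. -/
def AcceptsSince (q : 𝒜.Loc) (r : ℝ) (h : ℕ) : Prop :=
  𝒜.AcceptsFrom ρ (State.at q (ρ.timeAt h - r) h)

variable (𝒜 ρ) in
/-- `𝒜` accepts from the state that a literal leads to, when the literal is chosen at head position
`h` and the clock was reset at time `r`. -/
def AcceptsLiteral (r : ℝ) (h : ℕ) : Literal 𝒜.Loc → Prop
  | .free .top => True
  | .free .bot => False
  | .free (.loc q) => 𝒜.AcceptsSince ρ q r h
  | .reset .top => True
  | .reset .bot => False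
  | .reset (.loc q) => 𝒜.AcceptsSince ρ q (ρ.timeAt h) h

theorem not_acceptsFrom_bot : ¬ 𝒜.AcceptsFrom ρ State.bot := by
  rintro ⟨n, hn⟩
  induction n with
  | zero => cases hn
  | succ n ih =>
    obtain ⟨C, rfl, h⟩ := hn
    exact ih (h _ rfl)

theorem acceptsLiteral_iff {r : ℝ} {h : ℕ} {l : Literal 𝒜.Loc} :
    𝒜.AcceptsLiteral ρ r h l ↔ 𝒜.AcceptsFrom ρ (l.toState (ρ.timeAt h - r) h) := by
  rcases l with (_ | _ | q) | (_ | _ | q)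
  · exact iff_of_true trivial acceptsFrom_top
  · exact iff_of_false id not_acceptsFrom_bot
  · exact Iff.rfl
  · exact iff_of_true trivial acceptsFrom_top
  · exact iff_of_false id not_acceptsFrom_bot
  · simp [AcceptsLiteral, AcceptsSince, Literal.toState, ExtLoc.toState]

theorem acceptsSince_iff {q : 𝒜.Loc} {r : ℝ} {h : ℕ} :
    𝒜.AcceptsSince ρ q r h ↔ ∃ h' : ℕ, h' ≤ ρ.length + 1 ∧
      (𝒜.forward q ∧ h' = h + 1 ∨ ¬ 𝒜.forward q ∧ h' + 1 = h) ∧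
      ∃ g : 𝒜.guards, ρ.timeAt h' - r ∈ (g : TimeInterval).toSet ∧
        ∃ c ∈ 𝒜.δ q (ρ.symbolAt h') g, ∀ l ∈ c, 𝒜.AcceptsLiteral ρ r h' l := by
  have hclock : ∀ h', ρ.timeAt h - r + ρ.timeAt h' - ρ.timeAt h = ρ.timeAt h' - r :=
    fun h' => by ring
  simp only [acceptsLiteral_iff]
  constructor
  · rintro ⟨_ | n, hn⟩
    · cases hn
    · obtain ⟨_, ⟨h', hh', hdir, g, hg, c, hc, rfl⟩, hC⟩ := hn
      rw [hclock] at hg hC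
      exact ⟨h', hh', hdir, g, hg, c, hc, fun l hl => ⟨n, hC _ ⟨l, hl, rfl⟩⟩⟩
  · rintro ⟨h', hh', hdir, g, hg, c, hc, hC⟩
    choose! n hn using hC
    refine ⟨c.sup n + 1, _, ⟨h', hh', hdir, g, (hclock h').symm ▸ hg, c, hc, rfl⟩, ?_⟩
    rintro _ ⟨l, hl, rfl⟩
    rw [hclock]
    exact (hn l hl).mono (Finset.le_sup hl)

end TwoWayATA

/-! ### A two-way automaton for the language -/

namespace InsertErrAutomaton

/-- Locations of the automaton. The locations `start`, `scan`, `middle` and `last` do not constrain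
the clock: they guess a position `p`, and call the checkers `back i _`, `fwd i _` to verify
condition `i` on the time of `p` (`i = 0`), of `p + 1` (`i = 1, 2`) and of `p + 2` (`i = 3`, if
that position exists). The locations `inside _` verify that the second and the third time are in
`(0, 1)`, the locations `outside _` that the fourth time is at least `1`. A checker, called with a
clock reset, goes back to the left end marker (`back`), and then counts forward to the second or
third position (`fwd`, with the number of letters still to be skipped). The header of a checker
must not be re-entered without reset, hence the Boolean. -/
inductive Location where
  | start | scan | middle | last
  | inside (k : Fin 2)
  | outside (k : Fin 3)
  | back (i : Fin 4) (isHeader : Bool)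
  | fwd (i : Fin 4) (k : Fin 3)
deriving Fintype

open Location TimeInterval

/-- The number of the island of a location: `0` is that of the initial location, `3 + i` that of
checker `i`. -/
def island : Location → Fin 7
  | .inside _ => 1
  | .outside _ => 2
  | .back i _ | .fwd i _ => Fin.natAdd 3 i
  | _ => 0

/-- The headers of the islands. -/
def header : Fin 7 → Location
  | 0 => start
  | 1 => inside 0
  | 2 => outside 0
  | 3 => back 0 true
  | 4 => back 1 true
  | 5 => back 2 true
  | 6 => back 3 true

/-- Only the locations `back _ _` move backward. -/
def forward : Location → Prop
  | .back _ _ => False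
  | _ => True

/-- The time of the second position (`i = 0, 1`) or of the third position (`i = 2, 3`), relative to
the position where checker `i` is called, has to be in this interval. -/
def checkGuard : Fin 4 → TimeInterval
  | 0 => bounded (-1) 0 false true (by decide) (by decide)
  | 1 => coray (-1) true (by decide)
  | 2 => bounded (-1) 0 true true (by decide) (by decide)
  | 3 => coray (-1) false (by decide)

/-- The number of letters that checker `i` skips after it has gone back to the left end marker. -/
def skip : Fin 4 → Fin 3
  | 0 | 1 => 1
  | 2 | 3 => 2

/-- The guard `[0, ∞)`, which always holds outside the checkers. Since a guard cannot contain both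
positive and negative numbers, there is no guard that holds for all clock values. -/
abbrev nonneg : TimeInterval := ray 0 le_rfl

/-- The guard `(-∞, 0]`, which always holds in a checker on its way back to the left end marker
and forward to its target. -/
abbrev nonpos : TimeInterval := coray 0 true le_rfl

/-- The literal `q`. -/
abbrev stay (q : Location) : Literal Location := .free (.loc q)

/-- The literal `x.q`. -/
abbrev call (q : Location) : Literal Location := .reset (.loc q)

/-- The literal `⊤`. -/
abbrev accept : Literal Location := .free .top

/-- The transitions, as lists of guards with conjunctions of literals. Transitions that are not
listed have the empty disjunction as their formula. -/
def transitions {A : Type} : Location → Marked A → List (TimeInterval × List (Literal Location))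
  | start, .letter _ => [(nonneg, [call (inside 0), call (outside 0), stay scan])]
  | scan, .letter _ => [(nonneg, [stay scan]), (nonneg, [call (back 0 true), stay middle])]
  | middle, .letter _ => [(nonneg, [call (back 1 true), call (back 2 true), stay last])]
  | last, .letter _ => [(nonneg, [call (back 3 true)])]
  | last, .right => [(nonneg, [accept])]
  | inside 0, .letter _ => [(bounded 0 1 false false (by decide) (by decide), [stay (inside 1)])]
  | inside 1, .letter _ => [(bounded 0 1 false false (by decide) (by decide), [accept])]
  | outside 0, .letter _ => [(nonneg, [stay (outside 1)])]
  | outside 1, .letter _ => [(nonneg, [stay (outside 2)])]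
  | outside 2, .letter _ => [(ray 1 (by decide), [accept])]
  | back i _, .letter _ => [(nonpos, [stay (back i false)])]
  | back i _, .left => [(nonpos, [stay (fwd i (skip i))])]
  | fwd i 2, .letter _ => [(nonpos, [stay (fwd i 1)])]
  | fwd i 1, .letter _ => [(nonpos, [stay (fwd i 0)])]
  | fwd i 0, .letter _ => [(checkGuard i, [accept])]
  | _, _ => []

open Classical in
/-- All guards in `transitions`. -/
noncomputable def guards : Finset TimeInterval :=
  {nonneg, nonpos, ray 1 (by decide), bounded 0 1 false false (by decide) (by decide),
    checkGuard 0, checkGuard 1, checkGuard 2, checkGuard 3}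

theorem mem_guards {A : Type} {q : Location} {a : Marked A}
    {x : TimeInterval × List (Literal Location)} (hx : x ∈ transitions q a) : x.1 ∈ guards := by
  unfold transitions at hx
  split at hx <;> simp only [List.mem_cons, List.not_mem_nil, or_false] at hx
  case h_2 =>
    rcases hx with rfl | rfl <;> simp [guards]
  case h_15 =>
    subst hx
    rename_i i _
    fin_cases i <;> simp [guards]
  all_goals first | exact hx.elim | (subst hx; simp [guards])

open Classical in
/-- The transition function given by `transitions`. -/
noncomputable def delta {A : Type} (q : Location) (a : Marked A) (g : guards) : DNF Location :=
  (((transitions q a).filter fun x => x.1 = g.1).map fun x => x.2.toFinset).toFinset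

theorem mem_delta {A : Type} {q : Location} {a : Marked A} {g : guards}
    {c : Finset (Literal Location)} :
    c ∈ delta q a g ↔ ∃ x ∈ transitions q a, x.1 = g.1 ∧ ∀ l, l ∈ c ↔ l ∈ x.2 := by
  simp only [delta, List.mem_toFinset, List.mem_map, List.mem_filter, decide_eq_true_eq, and_assoc,
    Finset.ext_iff]
  grind

/-- At the left end marker the head turns; at the right end marker the run ends in `⊤`. -/
theorem transition_turn {A : Type} {q q' : Location} {a : Marked A}
    {x : TimeInterval × List (Literal Location)} (hx : x ∈ transitions q a) {l : Literal Location}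
    (hl : l ∈ x.2) (hq' : l.target = .loc q') :
    (a = .left → forward q') ∧ (a = .right → False) := by
  unfold transitions at hx
  split at hx <;> simp only [List.mem_cons, List.not_mem_nil, or_false] at hx
  case h_2 => simp
  case h_5 =>
    subst hx
    simp at hl
    subst hl
    simp [Literal.target] at hq'
  all_goals first | exact hx.elim | simp
  case h_12 =>
    subst hx; simp at hl; subst hl; simp [Literal.target] at hq'; subst hq'; trivial

theorem conj_ne_nil {A : Type} {q : Location} {a : Marked A}
    {x : TimeInterval × List (Literal Location)} (hx : x ∈ transitions q a) : x.2 ≠ [] := by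
  unfold transitions at hx
  split at hx <;> simp only [List.mem_cons, List.not_mem_nil, or_false] at hx
  case h_2 =>
    rcases hx with rfl | rfl <;> simp
  all_goals first | exact hx.elim | (subst hx; simp)

theorem free_transition {A : Type} {q q' : Location} {a : Marked A}
    {x : TimeInterval × List (Literal Location)} (hx : x ∈ transitions q a)
    (hl : stay q' ∈ x.2) : island q' = island q ∧ q' ≠ header (island q) := by
  unfold transitions at hx
  split at hx <;> simp only [List.mem_cons, List.not_mem_nil, or_false] at hx
  case h_2 => rcases hx with rfl | rfl <;> simp at hl <;> subst hl <;> simp [island, header]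
  case h_11 =>
    subst hx
    rename_i i _ _
    simp at hl
    subst hl
    fin_cases i <;> simp [island, header]
  case h_12 | h_13 | h_14 =>
    subst hx
    rename_i i _
    simp at hl
    subst hl
    fin_cases i <;> simp [island, header]
  all_goals first | exact hx.elim | (subst hx; simp at hl; try (subst hl; simp [island, header]))

/-- Calls lead to headers of islands with larger numbers. -/
theorem reset_transition {A : Type} {q q' : Location} {a : Marked A}
    {x : TimeInterval × List (Literal Location)} (hx : x ∈ transitions q a)
    (hl : call q' ∈ x.2) : (∃ j, header j = q') ∧ island q < island q' := by
  unfold transitions at hx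
  split at hx <;> simp only [List.mem_cons, List.not_mem_nil, or_false] at hx
  case h_1 =>
    subst hx; simp at hl
    rcases hl with rfl | rfl
    · exact ⟨⟨1, rfl⟩, by decide⟩
    · exact ⟨⟨2, rfl⟩, by decide⟩
  case h_2 =>
    rcases hx with rfl | rfl
    · simp at hl
    · simp at hl; subst hl; exact ⟨⟨3, rfl⟩, by decide⟩
  case h_3 =>
    subst hx; simp at hl
    rcases hl with rfl | rfl
    · exact ⟨⟨4, rfl⟩, by decide⟩
    · exact ⟨⟨5, rfl⟩, by decide⟩
  case h_4 =>
    subst hx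
    simp at hl
    subst hl
    exact ⟨⟨6, rfl⟩, by decide⟩
  all_goals first | exact hx.elim | (subst hx; simp at hl)

/-- Two points that lie in all guards used in an island. -/
noncomputable def commonPoints : Fin 7 → ℝ × ℝ
  | 0 | 2 => (1, 2)
  | 1 => (1 / 4, 1 / 2)
  | 3 | 5 => (-1 / 2, 0)
  | 4 | 6 => (-3, -2)

theorem commonPoints_natAdd (i : Fin 4) :
    commonPoints (Fin.natAdd 3 i) = ![(-1 / 2, 0), (-3, -2), (-1 / 2, 0), (-3, -2)] i := by
  fin_cases i <;> rfl

theorem commonPoints_mem {A : Type} {q : Location} {a : Marked A}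
    {x : TimeInterval × List (Literal Location)} (hx : x ∈ transitions q a) :
    (commonPoints (island q)).1 ∈ x.1.toSet ∧ (commonPoints (island q)).2 ∈ x.1.toSet := by
  unfold transitions at hx
  split at hx <;> simp only [List.mem_cons, List.not_mem_nil, or_false] at hx
  case h_2 =>
    rcases hx with rfl | rfl <;> simp [island, commonPoints]
  case h_11 =>
    subst hx
    rename_i i _ _
    simp only [island, commonPoints_natAdd]
    fin_cases i <;> norm_num
  case h_12 | h_13 | h_14 =>
    subst hx
    rename_i i _
    simp only [island, commonPoints_natAdd]
    fin_cases i <;> norm_num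
  case h_15 =>
    subst hx
    rename_i i _
    simp only [island, commonPoints_natAdd]
    fin_cases i <;> norm_num [checkGuard]
  all_goals first | exact hx.elim | (subst hx; norm_num [island, commonPoints])

/-- The automaton for `insertErr`, over any alphabet. -/
noncomputable def automaton (A : Type) : TwoWayATA A where
  Loc := Location
  finite_loc := inferInstance
  forward := forward
  init := .loc start
  guards := guards
  δ := delta
  conj_nonempty q a g c hc := by
    obtain ⟨x, hx, -, hl⟩ := mem_delta.1 hc
    obtain ⟨l, h⟩ := List.exists_mem_of_ne_nil _ (conj_ne_nil hx)
    exact ⟨l, (hl l).2 h⟩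
  left_turn q g _ c hc l hl q' hq' := by
    obtain ⟨x, hx, -, hl'⟩ := mem_delta.1 hc
    exact (transition_turn hx ((hl' l).1 hl) hq').1 rfl
  right_turn q g _ c hc l hl q' hq' := by
    obtain ⟨x, hx, -, hl'⟩ := mem_delta.1 hc
    exact ((transition_turn hx ((hl' l).1 hl) hq').2 rfl).elim

theorem automaton_isNonAdjacentRfl (A : Type) : (automaton A).IsNonAdjacentRfl := by
  refine ⟨7, island, header, ⟨?_, ?_, ?_, ?_⟩, ⟨fun i j => j < i, inferInstance, ?_⟩, fun j => ?_⟩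
  · intro j
    fin_cases j <;> rfl
  · rintro q hq
    exact ⟨0, ExtLoc.loc.inj hq⟩
  · rintro q q' ⟨a, g, c, hc, hl⟩
    obtain ⟨x, hx, -, hl'⟩ := mem_delta.1 hc
    exact free_transition hx ((hl' _).1 hl)
  · rintro q q' ⟨a, g, c, hc, hl⟩
    obtain ⟨x, hx, -, hl'⟩ := mem_delta.1 hc
    exact (reset_transition hx ((hl' _).1 hl)).1
  · rintro q q' ⟨a, g, c, hc, hl⟩
    obtain ⟨x, hx, -, hl'⟩ := mem_delta.1 hc
    exact (reset_transition hx ((hl' _).1 hl)).2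
  · refine nonAdjacent_of_common_points (x := (commonPoints j).1) (y := (commonPoints j).2) ?_ ?_
    · fin_cases j <;> norm_num [commonPoints]
    · rintro I ⟨q, a, g, rfl, ⟨c, hc⟩, rfl⟩
      obtain ⟨x, hx, hg, -⟩ := mem_delta.1 hc
      exact hg ▸ commonPoints_mem hx

variable {A : Type} {ρ : TimedWord A}

variable (ρ) in
/-- The automaton accepts from the location `q` at position `h` if the clock was reset at
time `r`. -/
def Since (q : Location) (r : ℝ) (h : ℕ) : Prop := (automaton A).AcceptsSince ρ q r h

variable (ρ) in
/-- The automaton accepts from the state reached by the literal `l`. -/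
def Lit (r : ℝ) (h : ℕ) (l : Literal Location) : Prop := (automaton A).AcceptsLiteral ρ r h l

@[simp] theorem lit_accept {r : ℝ} {h : ℕ} : Lit ρ r h accept ↔ True := Iff.rfl

@[simp] theorem lit_stay {r : ℝ} {h : ℕ} {q : Location} :
    Lit ρ r h (stay q) ↔ Since ρ q r h := Iff.rfl

@[simp] theorem lit_call {r : ℝ} {h : ℕ} {q : Location} :
    Lit ρ r h (call q) ↔ Since ρ q (ρ.timeAt h) h := Iff.rfl

theorem since_iff {q : Location} {r : ℝ} {h : ℕ} :
    Since ρ q r h ↔ ∃ h' : ℕ, h' ≤ ρ.length + 1 ∧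
      (forward q ∧ h' = h + 1 ∨ ¬ forward q ∧ h' + 1 = h) ∧
      ∃ x ∈ transitions q (ρ.symbolAt h'), ρ.timeAt h' - r ∈ x.1.toSet ∧
        ∀ l ∈ x.2, Lit ρ r h' l := by
  refine (TwoWayATA.acceptsSince_iff (𝒜 := automaton A)).trans ?_
  refine exists_congr fun h' => and_congr_right fun _ => and_congr_right fun _ => ?_
  constructor
  · rintro ⟨g, hg, c, hc, hC⟩
    obtain ⟨x, hx, hxg, hl⟩ := mem_delta.1 hc
    exact ⟨x, hx, hxg ▸ hg, fun l h => hC l ((hl l).2 h)⟩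
  · rintro ⟨x, hx, hg, hC⟩
    classical
    exact ⟨⟨x.1, mem_guards hx⟩, hg, x.2.toFinset, mem_delta.2 ⟨x, hx, rfl, by simp⟩,
      fun l h => hC l (List.mem_toFinset.1 h)⟩

theorem symbolAt_succ {h : ℕ} (hh : h < ρ.length) :
    ρ.symbolAt (h + 1) = .letter (ρ.letter ⟨h, hh⟩) := dif_pos hh

theorem symbolAt_length_succ : ρ.symbolAt (ρ.length + 1) = .right := dif_neg (lt_irrefl _)

theorem since_forward_iff {q : Location} (hq : forward q) {r : ℝ} {h : ℕ} :
    Since ρ q r h ↔ h ≤ ρ.length ∧ ∃ x ∈ transitions q (ρ.symbolAt (h + 1)),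
      ρ.timeAt (h + 1) - r ∈ x.1.toSet ∧ ∀ l ∈ x.2, Lit ρ r (h + 1) l := by
  rw [since_iff]
  constructor
  · rintro ⟨h', hh, ⟨-, rfl⟩ | ⟨hn, -⟩, hx⟩
    · exact ⟨by omega, hx⟩
    · exact absurd hq hn
  · rintro ⟨hh, hx⟩
    exact ⟨h + 1, by omega, Or.inl ⟨hq, rfl⟩, hx⟩

/-- Forward moving locations other than `last` can only read a letter. -/
theorem since_forward_letter_iff {q : Location} (hq : forward q)
    (hr : transitions (A := A) q .right = []) {r : ℝ} {h : ℕ} :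
    Since ρ q r h ↔ ∃ hh : h < ρ.length, ∃ x ∈ transitions q (.letter (ρ.letter ⟨h, hh⟩)),
      ρ.timeAt (h + 1) - r ∈ x.1.toSet ∧ ∀ l ∈ x.2, Lit ρ r (h + 1) l := by
  rw [since_forward_iff hq]
  rcases lt_trichotomy h ρ.length with hh | rfl | hh
  · simp [hh, hh.le, symbolAt_succ hh]
  · simp [symbolAt_length_succ, hr]
  · simp [not_le.2 hh, not_lt.2 hh.le]

theorem since_start {h : ℕ} {r : ℝ} : Since ρ start r h ↔
    h < ρ.length ∧ r ≤ ρ.timeAt (h + 1) ∧ Since ρ (inside 0) (ρ.timeAt (h + 1)) (h + 1) ∧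
      Since ρ (outside 0) (ρ.timeAt (h + 1)) (h + 1) ∧ Since ρ scan r (h + 1) := by
  simp [since_forward_letter_iff (q := start) trivial rfl, transitions]
  tauto

theorem since_scan {h : ℕ} {r : ℝ} : Since ρ scan r h ↔
    h < ρ.length ∧ r ≤ ρ.timeAt (h + 1) ∧ (Since ρ scan r (h + 1) ∨
      Since ρ (back 0 true) (ρ.timeAt (h + 1)) (h + 1) ∧ Since ρ middle r (h + 1)) := by
  rw [since_forward_letter_iff (q := scan) trivial rfl]
  simp [transitions]
  grind

theorem since_middle {h : ℕ} {r : ℝ} : Since ρ middle r h ↔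
    h < ρ.length ∧ r ≤ ρ.timeAt (h + 1) ∧ Since ρ (back 1 true) (ρ.timeAt (h + 1)) (h + 1) ∧
      Since ρ (back 2 true) (ρ.timeAt (h + 1)) (h + 1) ∧ Since ρ last r (h + 1) := by
  simp [since_forward_letter_iff (q := middle) trivial rfl, transitions]
  tauto

theorem since_last {h : ℕ} (hh : h ≤ ρ.length) {r : ℝ} : Since ρ last r h ↔
    r ≤ ρ.timeAt (h + 1) ∧
      (h < ρ.length → Since ρ (back 3 true) (ρ.timeAt (h + 1)) (h + 1)) := by
  rw [since_forward_iff (q := last) trivial]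
  rcases hh.lt_or_eq with hl | rfl
  · simp [hl, hl.le, symbolAt_succ hl, transitions]
  · simp [symbolAt_length_succ, transitions]

theorem since_inside {h : ℕ} {r : ℝ} : Since ρ (inside 0) r h ↔
    h + 1 < ρ.length ∧ ρ.timeAt (h + 1) - r ∈ Set.Ioo (0 : ℝ) 1 ∧
      ρ.timeAt (h + 2) - r ∈ Set.Ioo (0 : ℝ) 1 := by
  simp [since_forward_letter_iff (q := inside 0) trivial rfl,
    since_forward_letter_iff (q := inside 1) trivial rfl, transitions]
  grind

theorem since_outside {h : ℕ} {r : ℝ} (hr : r ≤ ρ.timeAt (h + 1)) : Since ρ (outside 0) r h ↔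
    h + 2 < ρ.length ∧ 1 ≤ ρ.timeAt (h + 3) - r := by
  have := ρ.timeAt_monotone (show h + 1 ≤ h + 2 by omega)
  simp [since_forward_letter_iff (q := outside 0) trivial rfl,
    since_forward_letter_iff (q := outside 1) trivial rfl,
    since_forward_letter_iff (q := outside 2) trivial rfl, transitions]
  grind

theorem since_fwd_zero {i : Fin 4} {h : ℕ} {r : ℝ} : Since ρ (fwd i 0) r h ↔
    h < ρ.length ∧ ρ.timeAt (h + 1) - r ∈ (checkGuard i).toSet := by
  simp [since_forward_letter_iff (q := fwd i 0) trivial rfl, transitions]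

theorem since_fwd_one {i : Fin 4} {h : ℕ} {r : ℝ} : Since ρ (fwd i 1) r h ↔
    h < ρ.length ∧ ρ.timeAt (h + 1) ≤ r ∧ Since ρ (fwd i 0) r (h + 1) := by
  simp [since_forward_letter_iff (q := fwd i 1) trivial rfl, transitions]
  tauto

theorem since_fwd_two {i : Fin 4} {h : ℕ} {r : ℝ} : Since ρ (fwd i 2) r h ↔
    h < ρ.length ∧ ρ.timeAt (h + 1) ≤ r ∧ Since ρ (fwd i 1) r (h + 1) := by
  simp [since_forward_letter_iff (q := fwd i 2) trivial rfl, transitions]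
  tauto

theorem since_back_iff {i : Fin 4} {e : Bool} {r : ℝ} {h : ℕ} (hh : h ≤ ρ.length) :
    Since ρ (back i e) r (h + 1) ↔ ∃ x ∈ transitions (back i e) (ρ.symbolAt h),
      ρ.timeAt h - r ∈ x.1.toSet ∧ ∀ l ∈ x.2, Lit ρ r h l := by
  rw [since_iff]
  constructor
  · rintro ⟨h', -, ⟨hn, -⟩ | ⟨-, he⟩, hx⟩
    · exact hn.elim
    · obtain rfl : h' = h := by omega
      exact hx
  · intro hx
    exact ⟨h, by omega, Or.inr ⟨id, rfl⟩, hx⟩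

/-- Moving backward, a checker reaches the left end marker. -/
theorem since_back {i : Fin 4} {e : Bool} {r : ℝ} {h : ℕ} (hh : h ≤ ρ.length)
    (hr : ρ.timeAt h ≤ r) : Since ρ (back i e) r (h + 1) ↔ Since ρ (fwd i (skip i)) r 0 := by
  rw [since_back_iff hh]
  induction h generalizing e with
  | zero => simpa [TimedWord.symbolAt, transitions] using fun _ => hr
  | succ h ih =>
    have := (ρ.timeAt_monotone (Nat.le_succ h)).trans hr
    rw [symbolAt_succ (by omega)]
    simp only [transitions, List.mem_singleton, exists_eq_left, forall_eq, lit_stay, mem_coray,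
      if_true, Int.cast_zero, sub_nonpos, hr, true_and]
    rw [since_back_iff (by omega), ih (by omega) this]

/-- The position whose time is compared by checker `i` with that of the position of its call. -/
def target (i : Fin 4) : ℕ := skip i + 1

theorem since_header {i : Fin 4} {h : ℕ} (hi : target i ≤ h) (hh : h ≤ ρ.length) :
    Since ρ (back i true) (ρ.timeAt h) h ↔
      ρ.timeAt (target i) - ρ.timeAt h ∈ (checkGuard i).toSet := by
  obtain ⟨k, rfl⟩ : ∃ k, h = k + 1 := ⟨h - 1, by unfold target at hi; omega⟩
  rw [since_back (by omega) (ρ.timeAt_monotone (Nat.le_succ k))]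
  have h1 : ρ.timeAt 1 ≤ ρ.timeAt (k + 1) := ρ.timeAt_monotone (by omega)
  have hl : target i ≤ ρ.length := hi.trans hh
  match i with
  | 0 | 1 =>
    change 2 ≤ ρ.length at hl
    change Since ρ (fwd _ 1) _ 0 ↔ _
    rw [since_fwd_one, since_fwd_zero]
    simp only [show 0 < ρ.length by omega, show 0 + 1 < ρ.length by omega, h1, true_and, zero_add]
    rfl
  | 2 | 3 =>
    change 3 ≤ ρ.length at hl
    change 3 ≤ k + 1 at hi
    have h2 : ρ.timeAt 2 ≤ ρ.timeAt (k + 1) := ρ.timeAt_monotone (by omega)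
    change Since ρ (fwd _ 2) _ 0 ↔ _
    rw [since_fwd_two, since_fwd_one, since_fwd_zero]
    simp only [show 0 < ρ.length by omega, show 0 + 1 < ρ.length by omega,
      show 2 < ρ.length by omega, h1, h2, true_and, zero_add, one_add_one_eq_two]
    rfl

theorem since_scan_iff {h : ℕ} {r : ℝ} (hr : r ≤ ρ.timeAt (h + 1)) : Since ρ scan r h ↔
    ∃ p, h < p ∧ p ≤ ρ.length ∧ Since ρ (back 0 true) (ρ.timeAt p) p ∧ Since ρ middle r p := by
  by_cases hh : h < ρ.length
  · have ih := since_scan_iff (hr.trans (ρ.timeAt_monotone (Nat.le_succ (h + 1))))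
    rw [since_scan, ih]
    constructor
    · rintro ⟨-, -, ⟨p, hp, h'⟩ | h'⟩
      · exact ⟨p, by omega, h'⟩
      · exact ⟨h + 1, by omega, by omega, h'⟩
    · rintro ⟨p, hp, hl, h'⟩
      refine ⟨hh, hr, ?_⟩
      rcases (show h + 1 ≤ p from hp).eq_or_lt with rfl | hlt
      · exact Or.inr h'
      · exact Or.inl ⟨p, hlt, hl, h'⟩
  · rw [since_scan]
    exact iff_of_false (fun h' => hh h'.1) (fun ⟨p, hp, hl, _⟩ => hh (by omega))
termination_by ρ.length - h

/-- The automaton accepts iff the second and the third time are in `(0, 1)`, the fourth time is at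
least `1`, and for some position `p` the next position is the only one whose time is in
`[τ₂ + 1, τ₃ + 1]`, which can be seen from the times of `p`, `p + 1` and `p + 2`. -/
theorem accepts_iff : (automaton A).Accepts ρ ↔ 4 ≤ ρ.length ∧ ρ.timeAt 2 ∈ Set.Ioo (0 : ℝ) 1 ∧
    ρ.timeAt 3 ∈ Set.Ioo (0 : ℝ) 1 ∧ 1 ≤ ρ.timeAt 4 ∧ ∃ p, 3 ≤ p ∧ p < ρ.length ∧
      ρ.timeAt p < ρ.timeAt 2 + 1 ∧ ρ.timeAt 2 + 1 ≤ ρ.timeAt (p + 1) ∧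
      ρ.timeAt (p + 1) ≤ ρ.timeAt 3 + 1 ∧
      (p + 2 ≤ ρ.length → ρ.timeAt 3 + 1 < ρ.timeAt (p + 2)) := by
  have hinit : (automaton A).Accepts ρ ↔ Since ρ start 0 0 := by
    rw [TwoWayATA.accepts_iff_acceptsFrom]
    change _ ↔ (automaton A).AcceptsFrom ρ (.at start (ρ.timeAt 0 - 0) 0)
    rw [sub_zero]
    rfl
  have h23 := ρ.timeAt_monotone (show 2 ≤ 3 by omega)
  rw [hinit, since_start, zero_add, since_inside, since_outside (ρ.timeAt_monotone (by omega)),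
    since_scan_iff (ρ.timeAt_nonneg _)]
  simp only [ρ.timeAt_one, sub_zero, le_refl, true_and]
  constructor
  · rintro ⟨-, ⟨-, h2, h3⟩, ⟨hl, h4⟩, p, hp, hpl, hb0, hm⟩
    rw [since_middle] at hm
    obtain ⟨hpl', -, hb1, hb2, hlast⟩ := hm
    rw [since_last (by omega)] at hlast
    rw [since_header hp hpl] at hb0
    rw [since_header (show 2 ≤ p + 1 by omega) (by omega)] at hb1
    rw [since_header (show 3 ≤ p + 1 by omega) (by omega)] at hb2
    simp [target, skip, checkGuard] at hb0 hb1 hb2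
    have hp3 : 3 ≤ p := by
      by_contra hp3
      obtain rfl : p = 2 := by omega
      linarith [h2.1, h3.2]
    refine ⟨by omega, h2, h3, h4, p, hp3, hpl', by linarith, by linarith, by linarith, ?_⟩
    intro hp2
    have hb3 := hlast.2 (by omega)
    rw [since_header (show 3 ≤ p + 1 + 1 by omega) (by omega)] at hb3
    simp [target, skip, checkGuard] at hb3
    linarith
  · rintro ⟨hl, h2, h3, h4, p, hp, hpl, ha, hb, hc, hd⟩
    have h3p := ρ.timeAt_monotone hp
    have hpp := ρ.timeAt_monotone (Nat.le_succ p)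
    refine ⟨by omega, ⟨by omega, h2, h3⟩, ⟨by omega, h4⟩, p, by omega, by omega, ?_, ?_⟩
    · rw [since_header (show 2 ≤ p by omega) (by omega)]
      simp [target, skip, checkGuard]
      constructor <;> linarith
    · rw [since_middle, since_last (by omega),
        since_header (show 2 ≤ p + 1 by omega) (by omega),
        since_header (show 3 ≤ p + 1 by omega) (by omega)]
      refine ⟨hpl, ρ.timeAt_nonneg _, ?_, ?_, ρ.timeAt_nonneg _, fun hp2 => ?_⟩
      · simp [target, skip, checkGuard]
        linarith
      · simp [target, skip, checkGuard]
        constructor <;> linarith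
      · rw [since_header (show 3 ≤ p + 1 + 1 by omega) (by omega)]
        simp [target, skip, checkGuard]
        linarith [hd (by omega)]

end InsertErrAutomaton

/-- The language in terms of head positions. The points of the interval `[τ₂ + 1, τ₃ + 1]` are
consecutive, so a point in it is the only one iff neither of its neighbours is in it. -/
theorem mem_insertErr_iff {ρ : TimedWord (Letter Unit)} : ρ ∈ insertErr ↔
    4 ≤ ρ.length ∧ ρ.timeAt 2 ∈ Set.Ioo (0 : ℝ) 1 ∧
    ρ.timeAt 3 ∈ Set.Ioo (0 : ℝ) 1 ∧ 1 ≤ ρ.timeAt 4 ∧ ∃ p, 3 ≤ p ∧ p < ρ.length ∧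
      ρ.timeAt p < ρ.timeAt 2 + 1 ∧ ρ.timeAt 2 + 1 ≤ ρ.timeAt (p + 1) ∧
      ρ.timeAt (p + 1) ≤ ρ.timeAt 3 + 1 ∧
      (p + 2 ≤ ρ.length → ρ.timeAt 3 + 1 < ρ.timeAt (p + 2)) := by
  constructor
  · rintro ⟨hl, -, hin, ⟨p, hpl⟩, ⟨hp1, hp2⟩, huniq⟩
    simp only [← ρ.timeAt_succ] at hin hp1 hp2 huniq
    simp only [Nat.reduceAdd] at hin hp1 hp2 huniq
    have h2 := (hin ⟨1, by omega⟩).2 (Or.inl rfl)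
    have h3 := (hin ⟨2, by omega⟩).2 (Or.inr rfl)
    simp only [Nat.reduceAdd] at h2 h3
    have hp3 : 3 ≤ p := by
      by_contra hp3
      have := ρ.timeAt_monotone (show p + 1 ≤ 3 by omega)
      linarith [h2.1, h3.2]
    have h4 : 1 ≤ ρ.timeAt 4 := by
      by_contra h4
      have h34 := ρ.timeAt_monotone (show 3 ≤ 4 by omega)
      have := (hin ⟨3, by omega⟩).1 ⟨h3.1.trans_le h34, not_le.1 h4⟩
      simp at this
    refine ⟨by omega, h2, h3, h4, p, hp3, hpl, ?_, hp1, hp2, fun hp => ?_⟩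
    · by_contra hlt
      have := huniq ⟨p - 1, by omega⟩
      simp only [show p - 1 + 1 = p by omega, Fin.mk.injEq] at this
      have := this ⟨not_lt.1 hlt, (ρ.timeAt_monotone (Nat.le_succ p)).trans hp2⟩
      omega
    · by_contra hlt
      have := huniq ⟨p + 1, by omega⟩
      simp only [Fin.mk.injEq] at this
      have := this ⟨hp1.trans (ρ.timeAt_monotone (Nat.le_succ _)), not_lt.1 hlt⟩
      omega
  · rintro ⟨hl, h2, h3, h4, p, hp, hpl, ha, hb, hc, hd⟩
    refine ⟨by omega, ρ.first_zero _ rfl, ?_, ⟨p, hpl⟩, ?_, ?_⟩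
    · rintro ⟨i, hi⟩
      rw [← ρ.timeAt_succ hi]
      simp only [Fin.mk.injEq]
      match i with
      | 0 => simp [ρ.timeAt_one]
      | 1 => exact iff_of_true h2 (Or.inl rfl)
      | 2 => exact iff_of_true h3 (Or.inr rfl)
      | i + 3 =>
        have := ρ.timeAt_monotone (show 4 ≤ i + 4 by omega)
        exact iff_of_false (fun h => by linarith [h.2]) (by omega)
    · simp only [← ρ.timeAt_succ]
      exact ⟨hb, hc⟩
    · rintro ⟨i, hi⟩ hmem
      simp only [← ρ.timeAt_succ] at hmem
      obtain ⟨h1, h2⟩ := hmem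
      simp only [Nat.reduceAdd] at h1 h2
      rcases lt_trichotomy i p with hlt | rfl | hlt
      · have := ρ.timeAt_monotone (show i + 1 ≤ p by omega)
        linarith
      · rfl
      · have := ρ.timeAt_monotone (show p + 2 ≤ i + 1 by omega)
        linarith [hd (by omega)]

theorem automaton_language :
    (InsertErrAutomaton.automaton (Letter Unit)).language = insertErr :=
  Set.ext fun _ => InsertErrAutomaton.accepts_iff.trans mem_insertErr_iff.symm

/-! ### A sentence for the language -/

namespace GQMSO

open TimeInterval

variable {P : Type} {n m : ℕ}

/-- The formula `∃ t' ∈ t + I. φ(t, t')`; in `φ`, the anchor `t` is variable `0` and `t'` is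
variable `1`. -/
def existsWithin (I : TimeInterval) (φ : GQMSO P 2 0) (t : Fin n) : GQMSO P n m :=
  .timed t [(.ex, I)] (List.cons_ne_nil _ _) φ

/-- `t` has no predecessor. -/
def isFirst (t : Fin n) : GQMSO P n m := .not (.ex (.lt 0 t.succ))

/-- `t` has a predecessor, and every predecessor of `t` is the first position. -/
def isSecond (t : Fin n) : GQMSO P n m :=
  .and (.ex (.lt 0 t.succ)) (.not (.ex (.and (.lt 0 t.succ) (.not (isFirst 0)))))

/-- The second position precedes `t`, and every predecessor of `t` is the first or the second
position. -/
def isThird (t : Fin n) : GQMSO P n m :=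
  .and (.ex (.and (.lt 0 t.succ) (isSecond 0)))
    (.not (.ex (.and (.lt 0 t.succ) (.and (.not (isFirst 0)) (.not (isSecond 0))))))

/-- The time of `t` is in `(0, 1)`: the first position, whose time is `0`, is in `t + (-1, 0)`. -/
def inUnit (t : Fin n) : GQMSO P n m :=
  existsWithin (bounded (-1) 0 false false (by decide) (by decide)) (isFirst 1) t

/-- The time of `t` is at least `τ₂ + 1` and, provided that it is at least `τ₃`, at most `τ₃ + 1`. -/
def inWindow (t : Fin n) : GQMSO P n m :=
  .and (existsWithin (coray (-1) true (by decide)) (isSecond 1) t)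
    (existsWithin (bounded (-1) 0 true true (by decide) (by decide)) (isThird 1) t)

/-- The sentence that defines `insertErr`. -/
def insertErrSentence : GQMSO P 0 0 :=
  .and (.ex (isThird 0)) (.and
    (.not (.ex (.not (.and
      (.not (.and (inUnit 0) (.and (.not (isSecond 0)) (.not (isThird 0)))))
      (.not (.and (.not (inUnit 0)) (.not (.and (.not (isSecond 0)) (.not (isThird 0))))))))))
    (.ex (.and (inWindow 0) (.not (.ex (.and (inWindow 0) (.not (.eq 0 1))))))))

variable {ρ : TimedWord (Letter P)} {v : Fin n → Fin ρ.length} {V : Fin m → Set (Fin ρ.length)}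

theorem sat_isFirst {t : Fin n} : (isFirst t).Sat ρ v V ↔ (v t : ℕ) = 0 := by
  simp only [isFirst, Sat, Fin.cons_zero, Fin.cons_succ, Fin.lt_def, not_exists, not_lt]
  exact ⟨fun h => Nat.le_zero.1 (h ⟨0, by have := (v t).2; omega⟩), fun h i => by omega⟩

theorem sat_isSecond {t : Fin n} : (isSecond t).Sat ρ v V ↔ (v t : ℕ) = 1 := by
  simp only [isSecond, Sat, sat_isFirst, Fin.cons_zero, Fin.cons_succ, Fin.lt_def]
  constructor
  · rintro ⟨⟨i, hi⟩, h⟩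
    by_contra hne
    exact h ⟨⟨1, by have := (v t).2; omega⟩, by simp; omega, by simp⟩
  · intro h
    exact ⟨⟨⟨0, by have := (v t).2; omega⟩, by simp [h]⟩, fun ⟨i, hi, hi'⟩ => by omega⟩

theorem sat_isThird {t : Fin n} : (isThird t).Sat ρ v V ↔ (v t : ℕ) = 2 := by
  simp only [isThird, Sat, sat_isFirst, sat_isSecond, Fin.cons_zero, Fin.cons_succ, Fin.lt_def]
  constructor
  · rintro ⟨⟨i, hi⟩, h⟩
    by_contra hne
    exact h ⟨⟨2, by have := (v t).2; omega⟩, by simp; omega, by simp⟩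
  · intro h
    exact ⟨⟨⟨1, by have := (v t).2; omega⟩, by simp [h]⟩, fun ⟨i, hi, hi'⟩ => by omega⟩

theorem sat_existsWithin {I : TimeInterval} {φ : GQMSO P 2 0} {t : Fin n} :
    (existsWithin I φ t).Sat ρ v V ↔ ∃ j, ρ.time j - ρ.time (v t) ∈ I.toSet ∧
      φ.Sat ρ (Fin.cons (v t) (Fin.cons j Fin.elim0)) Fin.elim0 :=
  Iff.rfl

theorem sat_inUnit {t : Fin n} : (inUnit t).Sat ρ v V ↔ ρ.time (v t) ∈ Set.Ioo (0 : ℝ) 1 := by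
  have h0 : 0 < ρ.length := (Nat.zero_le _).trans_lt (v t).2
  simp only [inUnit, sat_existsWithin, sat_isFirst]
  change (∃ j : Fin ρ.length, _ ∧ (j : ℕ) = 0) ↔ _
  constructor
  · rintro ⟨j, hj, hj0⟩
    simp [ρ.first_zero j hj0] at hj
    exact ⟨hj.2, hj.1⟩
  · rintro ⟨h1, h2⟩
    refine ⟨⟨0, h0⟩, ?_, rfl⟩
    simp [ρ.first_zero ⟨0, h0⟩ rfl]
    exact ⟨h2, h1⟩

theorem sat_inWindow (hl : 3 ≤ ρ.length) {t : Fin n} : (inWindow t).Sat ρ v V ↔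
    ρ.time ⟨1, by omega⟩ + 1 ≤ ρ.time (v t) ∧ ρ.time ⟨2, by omega⟩ ≤ ρ.time (v t) ∧
      ρ.time (v t) ≤ ρ.time ⟨2, by omega⟩ + 1 := by
  simp only [inWindow, Sat, sat_existsWithin, sat_isSecond, sat_isThird]
  change (∃ j : Fin ρ.length, _ ∧ (j : ℕ) = 1) ∧ (∃ j : Fin ρ.length, _ ∧ (j : ℕ) = 2) ↔ _
  constructor
  · rintro ⟨⟨j, hj, hj1⟩, ⟨k, hk, hk2⟩⟩
    rw [show j = ⟨1, by omega⟩ from Fin.ext hj1] at hj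
    rw [show k = ⟨2, by omega⟩ from Fin.ext hk2] at hk
    simp at hj hk
    refine ⟨?_, ?_, ?_⟩ <;> linarith
  · rintro ⟨h1, h2, h3⟩
    refine ⟨⟨⟨1, by omega⟩, ?_, rfl⟩, ⟨⟨2, by omega⟩, ?_, rfl⟩⟩
    · simp
      linarith
    · simp
      constructor <;> linarith

theorem isNonAdjacent_existsWithin {I : TimeInterval} {φ : GQMSO P 2 0} {t : Fin n} {x y : ℝ}
    (hxy : x < y) (hx : x ∈ I.toSet) (hy : y ∈ I.toSet) (hφ : φ.IsNonAdjacent) :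
    (existsWithin I φ t : GQMSO P n m).IsNonAdjacent := by
  refine ⟨by simp, nonAdjacent_of_common_points hxy ?_, hφ⟩
  rintro J ⟨z, hz, rfl⟩
  obtain rfl := List.mem_singleton.1 hz
  exact ⟨hx, hy⟩

theorem isNonAdjacent_inUnit (t : Fin n) : (inUnit t : GQMSO P n m).IsNonAdjacent :=
  isNonAdjacent_existsWithin (x := -1 / 2) (y := -1 / 3) (by norm_num) (by norm_num)
    (by norm_num) trivial

theorem isNonAdjacent_inWindow (t : Fin n) : (inWindow t : GQMSO P n m).IsNonAdjacent :=
  ⟨isNonAdjacent_existsWithin (x := -2) (y := -1) (by norm_num) (by norm_num) (by norm_num)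
      (by simp [isSecond, isFirst, IsNonAdjacent]),
    isNonAdjacent_existsWithin (x := -1) (y := 0) (by norm_num) (by norm_num) (by norm_num)
      (by simp [isThird, isSecond, isFirst, IsNonAdjacent])⟩

theorem isNonAdjacent_insertErrSentence : (insertErrSentence (P := P)).IsNonAdjacent := by
  simp [insertErrSentence, IsNonAdjacent, isNonAdjacent_inUnit, isNonAdjacent_inWindow, isThird,
    isSecond, isFirst]

theorem insertErrSentence_language : (insertErrSentence (P := Unit)).language = insertErr := by
  ext ρ
  have hthird : (∃ i : Fin ρ.length, (i : ℕ) = 2) ↔ 3 ≤ ρ.length :=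
    ⟨fun ⟨i, hi⟩ => by omega, fun h => ⟨⟨2, by omega⟩, rfl⟩⟩
  change Sat ρ insertErrSentence _ _ ↔ _
  simp only [insertErrSentence, Sat, sat_isThird, sat_isSecond, sat_inUnit, Fin.cons_zero, hthird]
  rw [← exists_prop]
  refine exists_congr fun hl => ?_
  simp only [sat_inWindow hl, Fin.cons_zero]
  have hunit : (¬ ∃ i : Fin ρ.length, ¬ (¬ (ρ.time i ∈ Set.Ioo (0 : ℝ) 1 ∧ ¬ (i : ℕ) = 1 ∧
        ¬ (i : ℕ) = 2) ∧ ¬ (ρ.time i ∉ Set.Ioo (0 : ℝ) 1 ∧ ¬ (¬ (i : ℕ) = 1 ∧ ¬ (i : ℕ) = 2)))) ↔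
      ∀ i : Fin ρ.length, ρ.time i ∈ Set.Ioo (0 : ℝ) 1 ↔ i = ⟨1, by omega⟩ ∨ i = ⟨2, by omega⟩ := by
    rw [not_exists]
    refine forall_congr' fun i => ?_
    simp only [Fin.ext_iff]
    tauto
  rw [hunit, ρ.first_zero ⟨0, by omega⟩ rfl]
  simp only [true_and]
  refine and_congr_right fun hin => exists_congr fun p => ?_
  have h2 := ((hin ⟨1, by omega⟩).2 (Or.inl rfl)).1
  have h3 := ((hin ⟨2, by omega⟩).2 (Or.inr rfl)).2
  have hmem : ∀ q : Fin ρ.length, (ρ.time ⟨1, by omega⟩ + 1 ≤ ρ.time q ∧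
      ρ.time ⟨2, by omega⟩ ≤ ρ.time q ∧ ρ.time q ≤ ρ.time ⟨2, by omega⟩ + 1) ↔
      ρ.time q ∈ Set.Icc (ρ.time ⟨1, by omega⟩ + 1) (ρ.time ⟨2, by omega⟩ + 1) :=
    fun q => ⟨fun h => ⟨h.1, h.2.2⟩, fun h => ⟨h.1, by linarith [h.1], h.2⟩⟩
  simp only [hmem]
  refine and_congr_right fun _ => ?_
  rw [not_exists]
  refine forall_congr' fun q => ?_
  change ¬ (_ ∧ ¬ q = p) ↔ _
  tauto

end GQMSO

/-! ### One-way automata: acceptance computed backwards -/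

/-- The value of a transition formula depends only on membership in the model at the current and
at the reset clock value, and on the clock constraints satisfied. -/
theorem TransFormula.models_congr {Q : Type} {M M' : Set (Q × ℝ)} {v v' : ℝ}
    (hloc : ∀ q, (q, v) ∈ M ↔ (q, v') ∈ M') (hzero : ∀ q, (q, (0 : ℝ)) ∈ M ↔ (q, (0 : ℝ)) ∈ M')
    (hclock : ∀ (c : Cmp) (k : ℕ), c.Holds v k ↔ c.Holds v' k) (φ : TransFormula Q) :
    φ.Models M v ↔ φ.Models M' v' := by
  induction φ generalizing v v' with
  | top => exact Iff.rfl
  | bot => exact Iff.rfl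
  | loc q => exact hloc q
  | clock c k => exact hclock c k
  | and φ ψ hφ hψ => exact and_congr (hφ hloc hclock) (hψ hloc hclock)
  | or φ ψ hφ hψ => exact or_congr (hφ hloc hclock) (hψ hloc hclock)
  | reset φ hφ => exact hφ hzero fun _ _ => Iff.rfl

theorem TransFormula.Models.mono {Q : Type} {M M' : Set (Q × ℝ)} (hM : M ⊆ M') {v : ℝ}
    {φ : TransFormula Q} (h : φ.Models M v) : φ.Models M' v := by
  induction φ generalizing v with
  | top => trivial
  | bot => exact h
  | loc q => exact hM h
  | clock c k => exact h
  | and φ ψ hφ hψ => exact ⟨hφ h.1, hψ h.2⟩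
  | or φ ψ hφ hψ => exact h.imp hφ hψ
  | reset φ hφ => exact hφ h

/-- Clock constraints have integer constants, so they cannot tell points of `(0, 1)` apart. -/
theorem Cmp.holds_congr {v v' : ℝ} (hv : v ∈ Set.Ioo (0 : ℝ) 1) (hv' : v' ∈ Set.Ioo (0 : ℝ) 1)
    (c : Cmp) (k : ℕ) : c.Holds v k ↔ c.Holds v' k := by
  obtain ⟨h0, h1⟩ := hv
  obtain ⟨h0', h1'⟩ := hv'
  rcases Nat.eq_zero_or_pos k with rfl | hk
  · cases c <;> simp only [Cmp.Holds, Nat.cast_zero] <;> constructor <;> intro h <;> linarith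
  · have : (1 : ℝ) ≤ k := by exact_mod_cast hk
    cases c <;> simp only [Cmp.Holds] <;> constructor <;> intro h <;> linarith

namespace OneATA

variable {A : Type}

/-- `B.acceptFrom a t k i`: the states from which `B` accepts the `k` letters
`a i, …, a (i + k - 1)`, read at the times `t (i + 1), …, t (i + k)`, when the clock value of the
state is taken at time `t i`. -/
def acceptFrom (B : OneATA A) (a : ℕ → A) (t : ℕ → ℝ) : ℕ → ℕ → Set (B.Loc × ℝ)
  | 0, _ => {s | s.1 ∈ B.final}
  | k + 1, i => {s | (B.δ s.1 (a i)).Models (B.acceptFrom a t k (i + 1)) (s.2 + (t (i + 1) - t i))}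

theorem acceptFrom_congr (B : OneATA A) (a : ℕ → A) {t t' : ℕ → ℝ} (k : ℕ) {i : ℕ}
    (h : ∀ j, i ≤ j → t j = t' j) : B.acceptFrom a t k i = B.acceptFrom a t' k i := by
  induction k generalizing i with
  | zero => rfl
  | succ k ih =>
    have hk : B.acceptFrom a t k (i + 1) = B.acceptFrom a t' k (i + 1) :=
      ih fun j hj => h j (by omega)
    simp only [acceptFrom, hk, h i le_rfl, h (i + 1) (by omega)]

/-- An alternating automaton accepts iff its initial state lies in the backward acceptance set. -/
theorem accepts_iff_mem_acceptFrom (B : OneATA A) (ρ : TimedWord A) (a : ℕ → A) (t : ℕ → ℝ)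
    (ha : ∀ i : Fin ρ.length, ρ.letter i = a i) (ht : ∀ i ≤ ρ.length, ρ.timeAt i = t i) :
    B.Accepts ρ ↔ (B.init, (0 : ℝ)) ∈ B.acceptFrom a t ρ.length 0 := by
  constructor
  · rintro ⟨C, h0, hstep, hfin⟩
    have key : ∀ k i, i + k = ρ.length → C i ⊆ B.acceptFrom a t k i := by
      intro k
      induction k with
      | zero =>
        rintro i rfl
        exact hfin
      | succ k ih =>
        intro i hi s hs
        obtain ⟨M, hM, hC⟩ := hstep ⟨i, by omega⟩
        have := hM s hs
        simp only [ha, ht _ (show i + 1 ≤ ρ.length by omega), ht i (by omega)] at this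
        refine this.mono (Set.Subset.trans ?_ (ih (i + 1) (by omega)))
        rw [hC]
        exact Set.subset_biUnion_of_mem (u := M) hs
    exact key _ 0 (by omega) (by rw [h0]; rfl)
  · intro hinit
    -- Always choose the largest model; no state is left once the configuration is empty.
    let C : ℕ → Set (B.Loc × ℝ) := fun i => Nat.rec {(B.init, 0)}
      (fun i Ci => {s | Ci.Nonempty ∧ s ∈ B.acceptFrom a t (ρ.length - (i + 1)) (i + 1)}) i
    have hC : ∀ i, C i ⊆ B.acceptFrom a t (ρ.length - i) i := by
      rintro (_ | i) s hs
      · obtain rfl : s = (B.init, 0) := hs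
        exact hinit
      · exact hs.2
    refine ⟨C, rfl, fun i => ⟨fun _ => B.acceptFrom a t (ρ.length - (i + 1)) (i + 1), ?_, ?_⟩, ?_⟩
    · intro s hs
      have := hC i hs
      rw [show ρ.length - (i : ℕ) = (ρ.length - (i + 1)) + 1 by omega] at this
      rw [ha, ht _ (by omega), ht _ (by omega)]
      exact this
    · ext s
      simp only [Set.mem_iUnion, exists_prop]
      exact ⟨fun ⟨⟨x, hx⟩, h⟩ => ⟨x, hx, h⟩, fun ⟨x, hx, h⟩ => ⟨⟨x, hx⟩, h⟩⟩
    · intro s hs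
      have := hC _ hs
      rwa [Nat.sub_self] at this

end OneATA

/-! ### No one-way automaton recognizes the language -/

/-- The times `0, u, v, 1 + 2 / (2n + 4), 1 + 4 / (2n + 4), 1 + 6 / (2n + 4), …`. -/
noncomputable def gridTime (n : ℕ) (u v : ℝ) : ℕ → ℝ
  | 0 => 0
  | 1 => u
  | 2 => v
  | k + 3 => 1 + (2 * k + 2) / (2 * n + 4)

theorem gridTime_mono (n : ℕ) {u v : ℝ} (hu : 0 < u) (huv : u ≤ v) (hv : v < 1) :
    Monotone (gridTime n u v) := by
  refine monotone_nat_of_le_succ fun k => ?_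
  have hn : (0 : ℝ) < 2 * n + 4 := by positivity
  match k with
  | 0 => exact hu.le
  | 1 => exact huv
  | 2 =>
    have : (0 : ℝ) ≤ (2 * (0 : ℕ) + 2) / (2 * n + 4) := by positivity
    simp only [gridTime]
    linarith
  | k + 3 =>
    simp only [gridTime]
    push_cast
    gcongr
    linarith

/-- The only letter over a single proposition. -/
def unitLetter : Letter Unit := ⟨{()}, Finset.singleton_nonempty _⟩

/-- The word of length `n + 3` with the times of `gridTime`. -/
noncomputable def gridWord (n : ℕ) (u v : ℝ) (hu : 0 < u) (huv : u ≤ v) (hv : v < 1) :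
    TimedWord (Letter Unit) where
  length := n + 3
  letter _ := unitLetter
  time i := gridTime n u v i
  mono _ _ h := gridTime_mono n hu huv hv h
  first_zero i hi := by simp [hi, gridTime]

/-- Numbers in `(0, 1)` whose translates by `1` separate the last `n` times of `gridTime`. -/
noncomputable def gridCut (n a : ℕ) : ℝ := (2 * a + 1) / (2 * n + 4)

theorem gridCut_pos (n a : ℕ) : 0 < gridCut n a := by
  unfold gridCut
  positivity

theorem gridCut_lt_one {n a : ℕ} (h : a ≤ n) : gridCut n a < 1 := by
  have : (a : ℝ) ≤ n := by exact_mod_cast h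
  rw [gridCut, div_lt_one (by positivity)]
  linarith

theorem gridCut_strictMono (n : ℕ) : StrictMono (gridCut n) := by
  intro a b h
  have : (a : ℝ) < b := by exact_mod_cast h
  unfold gridCut
  gcongr

theorem gridCut_add_one_le_iff {n a k : ℕ} {u v : ℝ} :
    gridCut n a + 1 ≤ gridTime n u v (k + 3) ↔ a ≤ k := by
  have hn : (0 : ℝ) < 2 * n + 4 := by positivity
  rw [gridCut, gridTime, add_comm, add_le_add_iff_left, div_le_div_iff_of_pos_right hn]
  constructor
  · intro h
    have : (a : ℝ) < k + 1 := by linarith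
    have : a < k + 1 := by exact_mod_cast this
    omega
  · intro h
    have : (a : ℝ) ≤ k := by exact_mod_cast h
    linarith

theorem gridTime_le_gridCut_add_one_iff {n a k : ℕ} {u v : ℝ} :
    gridTime n u v (k + 3) ≤ gridCut n a + 1 ↔ k < a := by
  have hn : (0 : ℝ) < 2 * n + 4 := by positivity
  rw [gridCut, gridTime, add_comm _ (1 : ℝ), add_le_add_iff_left, div_le_div_iff_of_pos_right hn]
  constructor
  · intro h
    have : (k : ℝ) < a := by linarith
    exact_mod_cast this
  · intro h
    have : (k : ℝ) + 1 ≤ a := by exact_mod_cast h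
    linarith

/-- Exactly `b - a` of the last `n` points lie between the two cuts translated by `1`. -/
theorem gridWord_mem_insertErr_iff {n a b : ℕ} (hab : a < b) (hb : b ≤ n) :
    gridWord n (gridCut n a) (gridCut n b) (gridCut_pos n a) (gridCut_strictMono n hab).le
      (gridCut_lt_one hb) ∈ insertErr ↔ b = a + 1 := by
  have hua := gridCut_pos n a
  have hub := gridCut_lt_one hb
  have huv := gridCut_strictMono n hab
  set u := gridCut n a with hu
  set v := gridCut n b with hv
  have key : ∀ i, gridTime n u v i ∈ Set.Icc (u + 1) (v + 1) ↔ ∃ k, i = k + 3 ∧ a ≤ k ∧ k < b := by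
    intro i
    match i with
    | 0 => simp only [gridTime, Set.mem_Icc]; constructor <;> [intro h; (rintro ⟨k, h, -⟩)] <;>
            [linarith; omega]
    | 1 => simp only [gridTime, Set.mem_Icc]; constructor <;> [intro h; (rintro ⟨k, h, -⟩)] <;>
            [linarith; omega]
    | 2 => simp only [gridTime, Set.mem_Icc]; constructor <;> [intro h; (rintro ⟨k, h, -⟩)] <;>
            [linarith; omega]
    | k + 3 =>
      rw [Set.mem_Icc, hu, hv, gridCut_add_one_le_iff, gridTime_le_gridCut_add_one_iff]
      exact ⟨fun h => ⟨k, rfl, h⟩, by rintro ⟨k', h, h'⟩; obtain rfl : k = k' := by omega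
                                      exact h'⟩
  constructor
  · rintro ⟨_, -, -, p, -, hp⟩
    by_contra hne
    have h1 := hp ⟨a + 3, show a + 3 < n + 3 by omega⟩ ((key (a + 3)).2 ⟨a, rfl, by omega, by omega⟩)
    have h2 := hp ⟨a + 4, show a + 4 < n + 3 by omega⟩
      ((key (a + 4)).2 ⟨a + 1, rfl, by omega, by omega⟩)
    have := congrArg Fin.val (h1.trans h2.symm)
    simp at this
  · rintro rfl
    refine ⟨show 3 ≤ n + 3 by omega, rfl, ?_, ⟨a + 3, show a + 3 < n + 3 by omega⟩, ?_, ?_⟩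
    · rintro ⟨i, hi⟩
      rw [Fin.mk.injEq, Fin.mk.injEq]
      change gridTime n u v i ∈ Set.Ioo 0 1 ↔ i = 1 ∨ i = 2
      match i with
      | 0 => simp [gridTime]
      | 1 => simpa [gridTime] using ⟨hua, by linarith⟩
      | 2 => simpa [gridTime] using ⟨by linarith, hub⟩
      | k + 3 =>
        have : (0 : ℝ) ≤ (2 * k + 2) / (2 * n + 4) := by positivity
        refine iff_of_false (fun h => ?_) (by omega)
        have := h.2
        simp only [gridTime] at this
        linarith
    · exact (key (a + 3)).2 ⟨a, rfl, le_rfl, by omega⟩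
    · rintro ⟨p, hp⟩ h
      obtain ⟨k, rfl, h1, h2⟩ := (key p).1 h
      exact Fin.ext (show k + 3 = a + 3 by omega)

theorem timeAt_gridWord (n : ℕ) {u v : ℝ} (hu : 0 < u) (huv : u ≤ v) (hv : v < 1) {i : ℕ}
    (hi : i ≤ n + 3) : (gridWord n u v hu huv hv).timeAt i = gridTime n u v (i - 1) := by
  cases i with
  | zero => rfl
  | succ i => exact dif_pos (show i < n + 3 by omega)

namespace OneATA

/-- `acceptFrom` for `k` letters after position `i` of the grid word with second and third time
`u` and `v`. The subtraction truncates: both head positions `0` and `1` have time `0`. -/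
def gridAccept (B : OneATA (Letter Unit)) (n : ℕ) (u v : ℝ) (k i : ℕ) : Set (B.Loc × ℝ) :=
  B.acceptFrom (fun _ => unitLetter) (fun i => gridTime n u v (i - 1)) k i

/-- The locations that, at the third letter and with the clock reset at time `r`, accept the last
`n` letters of a grid word. The third letter is given the time `0`, which `mem_acceptAfterReset`
shows not to matter. -/
def acceptAfterReset (B : OneATA (Letter Unit)) (n : ℕ) (r : ℝ) : Set B.Loc :=
  {q | (q, 0 - r) ∈ B.gridAccept n 0 0 n 3}

/-- Whether a location with a given reset time accepts the last letters does not depend on the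
times of the second and the third letter. -/
theorem mem_acceptAfterReset {B : OneATA (Letter Unit)} {n : ℕ} (hn : 0 < n) {u v r : ℝ}
    {q : B.Loc} : q ∈ B.acceptAfterReset n r ↔ (q, v - r) ∈ B.gridAccept n u v n 3 := by
  obtain ⟨k, rfl⟩ : ∃ k, n = k + 1 := ⟨n - 1, by omega⟩
  have h4 : B.gridAccept (k + 1) 0 0 k 4 = B.gridAccept (k + 1) u v k 4 := by
    refine B.acceptFrom_congr _ _ fun j hj => ?_
    obtain ⟨j, rfl⟩ : ∃ i, j = i + 4 := ⟨j - 4, by omega⟩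
    rfl
  have h0 : 0 - r + (gridTime (k + 1) 0 0 3 - 0) = v - r + (gridTime (k + 1) u v 3 - v) := by
    simp only [gridTime]
    ring
  change (B.δ q unitLetter).Models (B.gridAccept (k + 1) 0 0 k 4) _ ↔
    (B.δ q unitLetter).Models (B.gridAccept (k + 1) u v k 4) _
  rw [h4]
  exact iff_of_eq (congrArg _ h0)

/-- If resetting at time `u` and resetting at time `u'` let the same locations accept the last
letters, then moving the second letter from `u` to `u'` does not change acceptance: when the second
and the third letter are read, all clock values are `0` or in `(0, 1)`, and only the locations reset
at the second letter can remember its time. -/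
theorem accepts_gridWord_congr (B : OneATA (Letter Unit)) {n : ℕ} (hn : 0 < n) {u u' v : ℝ}
    (hu : 0 < u) (huv : u < v) (hu' : 0 < u') (huv' : u' < v) (hv : v < 1)
    (h : B.acceptAfterReset n u = B.acceptAfterReset n u') :
    B.Accepts (gridWord n u v hu huv.le hv) ↔ B.Accepts (gridWord n u' v hu' huv'.le hv) := by
  rw [B.accepts_iff_mem_acceptFrom _ (fun _ => unitLetter) (fun i => gridTime n u v (i - 1))
      (fun _ => rfl) (fun i hi => timeAt_gridWord n hu huv.le hv hi),
    B.accepts_iff_mem_acceptFrom _ (fun _ => unitLetter) (fun i => gridTime n u' v (i - 1))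
      (fun _ => rfl) (fun i hi => timeAt_gridWord n hu' huv'.le hv hi)]
  have h3 : B.gridAccept n u v n 3 = B.gridAccept n u' v n 3 := by
    refine B.acceptFrom_congr _ _ fun j hj => ?_
    obtain ⟨j, rfl⟩ : ∃ i, j = i + 3 := ⟨j - 3, by omega⟩
    match j with
    | 0 => rfl
    | j + 1 => rfl
  -- After the second letter: locations reset by it, and locations that have not been reset.
  have h2 : ∀ q, (q, (0 : ℝ)) ∈ B.gridAccept n u v (n + 1) 2 ↔
      (q, (0 : ℝ)) ∈ B.gridAccept n u' v (n + 1) 2 := by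
    intro q
    change (B.δ q unitLetter).Models (B.gridAccept n u v n 3) (0 + (v - u)) ↔
      (B.δ q unitLetter).Models (B.gridAccept n u' v n 3) (0 + (v - u'))
    simp only [zero_add]
    refine TransFormula.models_congr (fun q => ?_) (fun q => by rw [h3])
      (Cmp.holds_congr ⟨by linarith, by linarith⟩ ⟨by linarith, by linarith⟩) _
    rw [← mem_acceptAfterReset hn, ← mem_acceptAfterReset hn, h]
  have h2' : ∀ q, (q, u) ∈ B.gridAccept n u v (n + 1) 2 ↔
      (q, u') ∈ B.gridAccept n u' v (n + 1) 2 := by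
    intro q
    change (B.δ q unitLetter).Models (B.gridAccept n u v n 3) (u + (v - u)) ↔
      (B.δ q unitLetter).Models (B.gridAccept n u' v n 3) (u' + (v - u'))
    rw [h3, add_sub_cancel, add_sub_cancel]
  have h1 : ∀ q, (q, (0 : ℝ)) ∈ B.gridAccept n u v (n + 2) 1 ↔
      (q, (0 : ℝ)) ∈ B.gridAccept n u' v (n + 2) 1 := by
    intro q
    change (B.δ q unitLetter).Models (B.gridAccept n u v (n + 1) 2) (0 + (u - 0)) ↔
      (B.δ q unitLetter).Models (B.gridAccept n u' v (n + 1) 2) (0 + (u' - 0))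
    simp only [zero_add, sub_zero]
    exact TransFormula.models_congr h2' h2
      (Cmp.holds_congr ⟨by linarith, by linarith⟩ ⟨by linarith, by linarith⟩) _
  change (B.δ B.init unitLetter).Models (B.gridAccept n u v (n + 2) 1) (0 + (0 - 0)) ↔
    (B.δ B.init unitLetter).Models (B.gridAccept n u' v (n + 2) 1) (0 + (0 - 0))
  simp only [zero_add, sub_zero]
  exact TransFormula.models_congr h1 h1 (fun _ _ => Iff.rfl) _

/-- With more cuts than sets of locations, two cuts `a < a'` are indistinguishable after a reset.
Then the automaton treats the cuts `a, a' + 1` (at least two points between them) like the cuts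
`a', a' + 1` (one point). -/
theorem language_ne_insertErr (B : OneATA (Letter Unit)) : B.language ≠ insertErr := by
  intro hB
  have := B.finite_loc
  have : Fintype (Set B.Loc) := Fintype.ofFinite _
  set n := Fintype.card (Set B.Loc) + 1 with hn
  obtain ⟨a, a', hne, heq⟩ := Fintype.exists_ne_map_eq_of_card_lt
    (fun a : Fin n => B.acceptAfterReset n (gridCut n a)) (by simp [hn])
  wlog hlt : a < a' generalizing a a'
  · exact this a' a hne.symm heq.symm (lt_of_le_of_ne (not_lt.1 hlt) hne.symm)
  have haa : (a : ℕ) < a' := hlt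
  have hn' : (a' : ℕ) + 1 ≤ n := a'.2
  have hcongr := B.accepts_gridWord_congr (by omega) (gridCut_pos n a)
    (gridCut_strictMono n (show (a : ℕ) < a' + 1 by omega)) (gridCut_pos n a')
    (gridCut_strictMono n (Nat.lt_succ_self a')) (gridCut_lt_one hn') heq
  have h1 := gridWord_mem_insertErr_iff (Nat.lt_succ_self a') hn'
  have h2 := gridWord_mem_insertErr_iff (show (a : ℕ) < a' + 1 by omega) hn'
  rw [← hB] at h1 h2
  have := h2.1 (hcongr.2 (h1.2 rfl))
  omega

end OneATA

end TimedLang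

theorem theorem3 :
    (∃ 𝒜 : TimedLang.TwoWayATA (TimedLang.Letter Unit),
      𝒜.IsNonAdjacentRfl ∧ 𝒜.language = TimedLang.insertErr) ∧
    (∃ φ : TimedLang.GQMSO Unit 0 0,
      φ.IsNonAdjacent ∧ φ.language = TimedLang.insertErr) ∧
    ¬ ∃ B : TimedLang.OneATA (TimedLang.Letter Unit),
      B.language = TimedLang.insertErr :=
  ⟨⟨_, TimedLang.InsertErrAutomaton.automaton_isNonAdjacentRfl _, TimedLang.automaton_language⟩,
    ⟨_, TimedLang.GQMSO.isNonAdjacent_insertErrSentence,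
      TimedLang.GQMSO.insertErrSentence_language⟩,
    fun ⟨B, hB⟩ => B.language_ne_insertErr hB⟩
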